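/- Let $\Gamma$ be a finite group, $\Gamma_*$ its set of conjugacy classes and $c^0\in\Gamma_*$ the class of the identity. For $n\ge 0$ let $\Gamma_n=\Gamma^n\rtimes S_n$ be the wreath product, with $(g,\sigma)(h,\tau)=(g\,\sigma(h),\sigma\tau)$, $\sigma(h)_i=h_{\sigma^{-1}(i)}$, and let $\Gamma_\infty=\bigcup_n\Gamma_n$ be the union under the natural embeddings $\Gamma_n\subset\Gamma_{n+1}$. For a cycle $(i_1\,i_2\cdots i_k)$ of $\sigma$ (fixed points being $1$-cycles) the cycle-product of $x=(g,\sigma)$ is $g_{i_k}\cdots g_{i_1}$, well defined up to conjugacy in $\Gamma$. Let $\mathcal P(\Gamma_*)$ be the set of families $\rho=(\rho(c))_{c\in\Gamma_*}$ of partitions, let $\|\rho\|$ be the sum of all parts of all $\rho(c)$, and let $\ell(\rho(c))$ be the number of parts of $\rho(c)$. The modified type of $x\in\Gamma_\infty$ is the $\lambda\in\mathcal P(\Gamma_*)$ such that, for $c\ne c^0$, the parts of $\lambda(c)$ are the lengths of the cycles of $x$ with cycle-product in $c$, and the parts of $\lambda(c^0)$ are the nonzero numbers $k-1$, where $k$ runs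 over the lengths of the cycles with cycle-product $1$. Let $\mathcal K_\lambda\subset\Gamma_\infty$ be the conjugacy class of all elements of modified type $\lambda$, and let $K_\lambda(n)\in\mathbb Z[\Gamma_n]$ be the sum of the elements of $\mathcal K_\lambda\cap\Gamma_n$; the nonzero $K_\nu(n)$, namely those with $n\ge\|\nu\|+\ell(\nu(c^0))$, form a $\mathbb Z$-basis of the class algebra $R_{\mathbb Z}(\Gamma_n)$, the center of $\mathbb Z[\Gamma_n]$. Write $$K_\lambda(n)K_\mu(n)=\sum_\nu a_{\lambda\mu}^\nu(n)\,K_\nu(n),\qquad a_{\lambda\mu}^\nu(n)\in\mathbb Z;$$ the integer $a_{\lambda\mu}^\nu(n)$ is determined when $n\ge\|\nu\|+\ell(\nu(c^0))$ and arbitrary otherwise. For $Y\subset\Gamma_\infty$ let $\mathbb N(Y)$ be the set of indices $j$ such that $\sigma(j)\ne j$ or $g_j\ne 1$ for some $(g,\sigma)\in Y$. For a class $\mathcal C$ of tuples of elements of $\Gamma_\infty$ under simultaneous conjugation let $|\mathbb N(\mathcal C)|$ be the common cardinality of $\mathbb N(x_1,\dots,x_r)$ for $(x_1,\dots,x_r)\in\mathcal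 C$. Theorem. Let $\lambda,\mu,\nu\in\mathcal P(\Gamma_*)$. 1. There is a unique polynomial $f_{\lambda\mu}^\nu\in\mathbb Q[t]$ such that $f_{\lambda\mu}^\nu(n)=a_{\lambda\mu}^\nu(n)$ for all $n\ge\|\nu\|+\ell(\nu(c^0))$. For fixed $\lambda,\mu$ only finitely many $f_{\lambda\mu}^\nu$ are nonzero, all values $f_{\lambda\mu}^\nu(n)$, $n\ge 0$, are integers, and $K_\lambda(n)K_\mu(n)=\sum_\nu f_{\lambda\mu}^\nu(n)K_\nu(n)$ for every $n\ge 0$; so, with the undetermined $a_{\lambda\mu}^\nu(n)$ suitably chosen, $f_{\lambda\mu}^\nu(n)=a_{\lambda\mu}^\nu(n)$ for all $n$. 2. If there is a pair $(x,y)$ with $x\in\mathcal K_\lambda$, $y\in\mathcal K_\mu$, $xy\in\mathcal K_\nu$, then $f_{\lambda\mu}^\nu\neq0$ and its degree is the greatest value of $|\mathbb N(\mathcal C)|-|\mathbb N(\mathcal K_\nu)|$ over all classes $\mathcal C$ of such pairs. If there is no such pair, then $f_{\lambda\mu}^\nu=0$. 3. If $\|\nu\|=\|\lambda\|+\|\mu\|$,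 then $f_{\lambda\mu}^\nu$ is a constant, equal to a non-negative integer, and $\mathbb N(x,y)=\mathbb N(xy)$ for all $x\in\mathcal K_\lambda$, $y\in\mathcal K_\mu$ with $xy\in\mathcal K_\nu$. -/

import Mathlib

open Polynomial

noncomputable section

namespace WreathFH

/-- The wreath product `Γ ≀ Sym(α)`: pairs `(g, σ)` with `g : α → Γ`, `σ` a permutation of `α`, and
`(g, σ)(h, τ) = (g σ(h), σ τ)`, where `σ(h) i = h (σ⁻¹ i)`. -/
abbrev Wreath (Γ : Type*) [Group Γ] (α : Type*) : Type _ :=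
  (α → Γ) ⋊[(mulAutArrow : Equiv.Perm α →* MulAut (α → Γ))] Equiv.Perm α

theorem mul_left_apply {Γ : Type*} [Group Γ] {α : Type*} (x y : Wreath Γ α) (j : α) :
    (x * y).left j = x.left j * y.left (x.right⁻¹ j) := rfl

theorem inv_left_apply {Γ : Type*} [Group Γ] {α : Type*} (x : Wreath Γ α) (j : α) :
    (x⁻¹).left j = (x.left (x.right j))⁻¹ := by
  simp [SemidirectProduct.inv_left, mulAutArrow]
  rfl

/-- The points moved by `σ` or carrying a nontrivial entry of `g`, for `x = (g, σ)`. -/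
def supp {Γ : Type*} [Group Γ] {α : Type*} (x : Wreath Γ α) : Set α :=
  {j | x.right j ≠ j ∨ x.left j ≠ 1}

theorem notMem_supp {Γ : Type*} [Group Γ] {α : Type*} {x : Wreath Γ α} {j : α} :
    j ∉ supp x ↔ x.right j = j ∧ x.left j = 1 := by
  simp [supp]

theorem supp_one {Γ : Type*} [Group Γ] {α : Type*} : supp (1 : Wreath Γ α) = ∅ := by
  ext j; simp [supp]

theorem supp_mul_subset {Γ : Type*} [Group Γ] {α : Type*} (x y : Wreath Γ α) :
    supp (x * y) ⊆ supp x ∪ supp y := by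
  intro j
  contrapose
  simp only [Set.mem_union, not_or, notMem_supp]
  rintro ⟨⟨h1, h2⟩, h3, h4⟩
  have h5 : x.right⁻¹ j = j := by rw [Equiv.Perm.inv_eq_iff_eq, h1]
  refine ⟨?_, ?_⟩
  · rw [SemidirectProduct.mul_right, Equiv.Perm.mul_apply, h3, h1]
  · rw [mul_left_apply, h5, h2, h4, one_mul]

theorem supp_inv_subset {Γ : Type*} [Group Γ] {α : Type*} (x : Wreath Γ α) :
    supp (x⁻¹) ⊆ supp x := by
  intro j
  contrapose
  simp only [notMem_supp]
  rintro ⟨h1, h2⟩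
  refine ⟨?_, ?_⟩
  · rw [SemidirectProduct.inv_right, Equiv.Perm.inv_eq_iff_eq, h1]
  · rw [inv_left_apply, h1, h2, inv_one]

/-- The wreath product `Γ_n = Γ^n ⋊ S_n`. -/
abbrev WreathFin (Γ : Type*) [Group Γ] (n : ℕ) : Type _ := Wreath Γ (Fin n)

/-- `Γ_∞`, the union of all `Γ_n`: the pairs `(g, σ)` over the countable index set `ℕ`
with finite support. -/
def wreathInf (Γ : Type*) [Group Γ] : Subgroup (Wreath Γ ℕ) where
  carrier := {x | (supp x).Finite}
  mul_mem' {x y} hx hy := (Set.Finite.union hx hy).subset (supp_mul_subset x y)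
  one_mem' := by simp [supp_one]
  inv_mem' {x} hx := Set.Finite.subset hx (supp_inv_subset x)

/-- The embedding of `Γ_n` in the wreath product over `ℕ`: extend `g` by `1` and `σ` by the
identity outside `{0, …, n - 1}`. -/
def extend (Γ : Type*) [Group Γ] (n : ℕ) : WreathFin Γ n →* Wreath Γ ℕ where
  toFun x :=
    ⟨fun j => if h : j < n then x.left ⟨j, h⟩ else 1,
      Equiv.Perm.extendDomainHom (Fin.equivSubtype (n := n)) x.right⟩
  map_one' := by
    ext j
    · simp
    · simp
  map_mul' x y := by
    apply SemidirectProduct.ext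
    · funext j
      rw [mul_left_apply]
      simp only [← map_inv]
      by_cases h : j < n
      · have e : Equiv.Perm.extendDomainHom (Fin.equivSubtype (n := n)) x.right⁻¹ j
            = ((x.right⁻¹ ⟨j, h⟩ : Fin n) : ℕ) := by
          exact Equiv.Perm.extendDomain_apply_image x.right⁻¹ Fin.equivSubtype ⟨j, h⟩
        simp only [e, h, dif_pos, Fin.is_lt, Fin.eta]
        rw [mul_left_apply]
      · have e : Equiv.Perm.extendDomainHom (Fin.equivSubtype (n := n)) x.right⁻¹ j = j :=
          Equiv.Perm.extendDomain_apply_not_subtype x.right⁻¹ Fin.equivSubtype h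
        simp only [e, h, dif_neg, not_false_iff, mul_one]
    · simp

theorem extend_mem (Γ : Type*) [Group Γ] (n : ℕ) (x : WreathFin Γ n) :
    extend Γ n x ∈ wreathInf Γ := by
  refine (Set.finite_lt_nat n).subset ?_
  intro j
  contrapose
  intro h
  have h' : ¬ j < n := h
  rw [notMem_supp]
  exact ⟨Equiv.Perm.extendDomain_apply_not_subtype x.right Fin.equivSubtype h',
    dif_neg h'⟩

/-- The natural embedding `Γ_n → Γ_∞`. -/
def toInf (Γ : Type*) [Group Γ] (n : ℕ) : WreathFin Γ n →* wreathInf Γ :=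
  (extend Γ n).codRestrict (wreathInf Γ) (extend_mem Γ n)

/-- A family of partitions indexed by the conjugacy classes of `Γ`; a partition is a finite
multiset of positive integers (its parts). -/
abbrev ModType (Γ : Type*) [Group Γ] : Type _ := ConjClasses Γ → Multiset ℕ+

/-- The degree `‖ρ‖`, the sum of all parts of all the partitions. -/
def degree {Γ : Type*} [Group Γ] (ρ : ModType Γ) : ℕ :=
  ∑ᶠ c : ConjClasses Γ, ((ρ c).map (fun k : ℕ+ => (k : ℕ))).sum

/-- The cycle-product `g_{i_k} ⋯ g_{i_2} g_{i_1}` of `x = (g, σ)` at the cycle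
`(i_1 i_2 ⋯ i_k)` of `σ`, where `i_1 = i` and `i_{s+1} = σ i_s`. -/
def cycleProduct {Γ : Type*} [Group Γ] {α : Type*} (x : Wreath Γ α) (i : α) : Γ :=
  ((List.range (Function.minimalPeriod x.right i)).map
    (fun s => x.left ((x.right ^ s) i))).reverse.prod

/-- The number of cycles of `x = (g, σ)` of length `r` (fixed points of `σ` being cycles of
length `1`) whose cycle-product lies in the conjugacy class `c`; that is, `m_r(ρ(c))` for the
type `ρ` of `x`. A cycle is identified with its underlying set. -/
def numCycles {Γ : Type*} [Group Γ] {α : Type*} (x : Wreath Γ α) (r : ℕ)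
    (c : ConjClasses Γ) : ℕ :=
  Set.ncard {s : Set α | ∃ i : α, s = {j | x.right.SameCycle i j} ∧ s.ncard = r ∧
    ConjClasses.mk (cycleProduct x i) = c}

/-- `lam` is the modified type of `x`: for `c ≠ 1`, `lam c` records the lengths of the cycles with
cycle-product in `c`; `lam 1` records the lengths, lowered by one, of the cycles with
trivial cycle-product (the resulting zeros being dropped). -/
def HasModType {Γ : Type*} [Group Γ] {α : Type*} (x : Wreath Γ α) (lam : ModType Γ) : Prop :=
  (∀ r : ℕ+, (lam 1).count r = numCycles x (r + 1) 1) ∧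
    ∀ c : ConjClasses Γ, c ≠ 1 → ∀ r : ℕ+, (lam c).count r = numCycles x r c

/-- The class `𝒦_lam` in `Γ_∞` of the elements of modified type `lam`. -/
def classInf {Γ : Type*} [Group Γ] (lam : ModType Γ) : Set (wreathInf Γ) :=
  {x | HasModType (x : Wreath Γ ℕ) lam}

/-- `K_lam(n)`, the sum of the elements of `Γ_n ∩ 𝒦_lam`, in the group algebra `ℤ[Γ_n]`
(whose center is the class algebra). -/
def classSum {Γ : Type*} [Group Γ] (n : ℕ) (lam : ModType Γ) :
    MonoidAlgebra ℤ (WreathFin Γ n) :=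
  ∑ᶠ x ∈ {x : WreathFin Γ n | toInf Γ n x ∈ classInf lam}, MonoidAlgebra.single x 1

/-- `a` is a system of structure constants for `K_lam(n) K_mu(n)`:
`K_lam(n) K_mu(n) = ∑_ν a ν K_ν(n)`. -/
def IsStructureConstants {Γ : Type*} [Group Γ] (n : ℕ) (lam mu : ModType Γ)
    (a : ModType Γ →₀ ℤ) : Prop :=
  classSum n lam * classSum n mu = a.sum fun ν m => m • classSum n ν

/-- `ℕ(Y)`, the union of the supports of the elements of `Y`. -/
def suppSet {Γ : Type*} [Group Γ] (Y : Set (wreathInf Γ)) : Set ℕ :=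
  {j | ∃ x ∈ Y, j ∈ supp (x : Wreath Γ ℕ)}

/-- Simultaneous conjugacy of `r`-tuples of elements of `Γ_∞`. -/
def tupleSetoid (Γ : Type*) [Group Γ] (r : ℕ) : Setoid (Fin r → wreathInf Γ) where
  r x y := ∃ z : wreathInf Γ, ∀ i, y i = z * x i * z⁻¹
  iseqv :=
    { refl := fun x => ⟨1, fun i => by simp⟩
      symm := by
        rintro x y ⟨z, hz⟩
        exact ⟨z⁻¹, fun i => by rw [hz i]; group⟩
      trans := by
        rintro x y w ⟨z, hz⟩ ⟨t, ht⟩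
        exact ⟨t * z, fun i => by rw [ht i, hz i]; group⟩ }

/-- The conjugacy classes of `r`-tuples of elements of `Γ_∞`. -/
abbrev TupleClass (Γ : Type*) [Group Γ] (r : ℕ) : Type _ := Quotient (tupleSetoid Γ r)

theorem mem_supp_conj {Γ : Type*} [Group Γ] {α : Type*} (z x : Wreath Γ α) (j : α) :
    z.right j ∈ supp (z * x * z⁻¹) ↔ j ∈ supp x := by
  rw [← not_iff_not, notMem_supp, notMem_supp]
  have hr : (z * x * z⁻¹).right (z.right j) = z.right (x.right j) := by simp
  rw [hr, (z.right).injective.eq_iff]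
  refine and_congr_right fun h => ?_
  have hl : (z * x * z⁻¹).left (z.right j)
      = z.left (z.right j) * x.left j * (z.left (z.right j))⁻¹ := by
    rw [mul_left_apply, mul_left_apply, inv_left_apply]
    have e : (z * x).right⁻¹ (z.right j) = j := by
      rw [Equiv.Perm.inv_eq_iff_eq, SemidirectProduct.mul_right, Equiv.Perm.mul_apply, h]
    have e' : z.right⁻¹ (z.right j) = j := by simp
    rw [e, e']
  rw [hl, conj_eq_one_iff]

theorem suppSet_conj {Γ : Type*} [Group Γ] {r : ℕ} (x y : Fin r → wreathInf Γ)
    (h : (tupleSetoid Γ r).r x y) :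
    (suppSet (Set.range x)).ncard = (suppSet (Set.range y)).ncard := by
  obtain ⟨z, hz⟩ := h
  rw [← Set.ncard_image_of_injective _ (z : Wreath Γ ℕ).right.injective]
  congr 1
  ext j
  obtain ⟨j, rfl⟩ := (z : Wreath Γ ℕ).right.surjective j
  rw [(z : Wreath Γ ℕ).right.injective.mem_set_image]
  simp only [suppSet, Set.mem_ofPred_eq, Set.exists_range_iff]
  refine exists_congr fun i => ?_
  rw [hz i]
  exact (mem_supp_conj _ _ _).symm

/-- `|ℕ(𝒞)|`, the common value of `|ℕ(x_1, …, x_r)|` for `(x_1, …, x_r) ∈ 𝒞`. -/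
def TupleClass.suppCard {Γ : Type*} [Group Γ] {r : ℕ} (C : TupleClass Γ r) : ℕ :=
  Quotient.lift (fun x : Fin r → wreathInf Γ => (suppSet (Set.range x)).ncard) suppSet_conj C

/-- The classes of pairs `(x, y)` with `x ∈ 𝒦_lam`, `y ∈ 𝒦_mu` and `x y ∈ 𝒦_nu`. -/
def pairClasses {Γ : Type*} [Group Γ] (lam mu nu : ModType Γ) : Set (TupleClass Γ 2) :=
  {C | ∃ x ∈ classInf lam, ∃ y ∈ classInf mu, x * y ∈ classInf nu ∧
    C = Quotient.mk (tupleSetoid Γ 2) ![x, y]}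

end WreathFH

end

/-!
Fix an element `z` of modified type `ν` with `m` points in `ℕ(z)`, and sort the factorizations
`z = x y` in `Γ_n`, with `x ∈ 𝒦_lam` and `y ∈ 𝒦_mu`, by the set `S ⊇ ℕ(z)` of points moved by `x` or
by `y`. Elements of the same modified type are conjugate, so the number of factorizations that
belong to `S` depends only on `d = |S| - m`; call it `N_d`. Hence
`a_{lam mu}^ν(n) = ∑_d N_d * choose (n - m) d`, a polynomial in `n` because `N_d = 0` for large `d`.
Now `N_d ≠ 0` exactly when some class `𝒞` of pairs has `|ℕ(𝒞)| = m + d`, and since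
`choose (t - m) d` has degree `d` the leading terms cannot cancel, which gives the degree.

For `‖ν‖ = ‖lam‖ + ‖mu‖`, let `Γ ≀ S_α` act on the functions `φ : α → Γ ∪ {0}`. The fixed points of
an element of modified type `lam` are cut out by `‖lam‖` equations `a φ(i) = b φ(j)` and number
exactly `(|Γ| + 1) ^ (|α| - ‖lam‖)`. Each such equation reduces the number of solutions at most by
the factor `|Γ| + 1`, so `x` and `y` have at least as many common fixed points as `x y` has fixed
points, and the two sets coincide. For the functions supported at a single point this says that
every point fixed by `x y` is fixed by `x` and by `y`, whence `N_d = 0` for `d > 0`.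
-/

noncomputable section

namespace WreathFH

universe u

variable {Γ : Type*} [Group Γ] {α β γ ι κ : Type*}

/-- The product `g_{i_s} ⋯ g_{i_2} g_{i_1}` along the first `s` steps of the `σ`-orbit of
`i = i_1`, for `x = (g, σ)`; the cycle-product is the case where `s` is the length of the cycle. -/
def partialProduct (x : Wreath Γ α) (s : ℕ) (i : α) : Γ :=
  ((List.range s).map (fun t => x.left ((x.right ^ t) i))).reverse.prod

theorem cycleProduct_eq_partialProduct (x : Wreath Γ α) (i : α) :
    cycleProduct x i = partialProduct x (Function.minimalPeriod x.right i) i := rfl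

@[simp]
theorem partialProduct_zero (x : Wreath Γ α) (i : α) : partialProduct x 0 i = 1 := by
  simp [partialProduct]

theorem partialProduct_succ (x : Wreath Γ α) (s : ℕ) (i : α) :
    partialProduct x (s + 1) i = x.left ((x.right ^ s) i) * partialProduct x s i := by
  simp [partialProduct, List.range_succ]

theorem pow_minimalPeriod_apply (σ : Equiv.Perm α) (i : α) :
    (σ ^ Function.minimalPeriod σ i) i = i := by
  rw [Equiv.Perm.coe_pow]; exact Function.iterate_minimalPeriod

theorem setOf_sameCycle_of_notMem_supp {x : Wreath Γ α} {i : α} (hi : i ∉ supp x) :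
    {j | x.right.SameCycle i j} = {i} :=
  Set.eq_singleton_iff_unique_mem.2 ⟨Equiv.Perm.SameCycle.refl _ _,
    fun _ hj => (Equiv.Perm.SameCycle.eq_of_left hj (notMem_supp.1 hi).1).symm⟩

theorem cycleProduct_of_notMem_supp {x : Wreath Γ α} {i : α} (hi : i ∉ supp x) :
    cycleProduct x i = 1 := by
  obtain ⟨hr, hl⟩ := notMem_supp.1 hi
  rw [cycleProduct_eq_partialProduct,
    Function.minimalPeriod_eq_one_iff_isFixedPt.2 (show Function.IsFixedPt x.right i from hr),
    partialProduct_succ]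
  simp [hl]

/-- `y` is obtained from `x` by relabelling the points along `e`, rescaling by `h`, and adding
trivial points. -/
structure Intertwines (e : α ↪ β) (h : α → Γ) (x : Wreath Γ α) (y : Wreath Γ β) : Prop where
  right (i : α) : y.right (e i) = e (x.right i)
  left (i : α) : y.left (e i) * h i = h (x.right i) * x.left i
  notMem_supp (j : β) : j ∉ Set.range e → j ∉ supp y

namespace Intertwines

variable {e : α ↪ β} {h : α → Γ} {x : Wreath Γ α} {y : Wreath Γ β}

theorem pow (H : Intertwines e h x y) (n : ℕ) (i : α) :
    (y.right ^ n) (e i) = e ((x.right ^ n) i) := by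
  induction n with
  | zero => simp
  | succ n ih => rw [pow_succ', pow_succ', Equiv.Perm.mul_apply, ih, H.right, Equiv.Perm.mul_apply]

theorem zpow (H : Intertwines e h x y) (n : ℤ) (i : α) :
    (y.right ^ n) (e i) = e ((x.right ^ n) i) := by
  cases n with
  | ofNat n => exact_mod_cast H.pow n i
  | negSucc n =>
    rw [zpow_negSucc, zpow_negSucc, Equiv.Perm.inv_eq_iff_eq, H.pow, ← Equiv.Perm.mul_apply,
      mul_inv_cancel, Equiv.Perm.one_apply]

theorem image_cycle (H : Intertwines e h x y) (i : α) :
    e '' {j | x.right.SameCycle i j} = {j | y.right.SameCycle (e i) j} := by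
  ext j
  constructor
  · rintro ⟨_, ⟨n, rfl⟩, rfl⟩
    exact ⟨n, H.zpow n i⟩
  · rintro ⟨n, rfl⟩
    exact ⟨(x.right ^ n) i, ⟨n, rfl⟩, (H.zpow n i).symm⟩

theorem ncard_cycle (H : Intertwines e h x y) (i : α) :
    {j | y.right.SameCycle (e i) j}.ncard = {j | x.right.SameCycle i j}.ncard := by
  rw [← H.image_cycle, Set.ncard_image_of_injective _ e.injective]

theorem minimalPeriod_eq (H : Intertwines e h x y) (i : α) :
    Function.minimalPeriod y.right (e i) = Function.minimalPeriod x.right i := by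
  rw [Function.minimalPeriod_eq_minimalPeriod_iff]
  intro n
  simp only [Function.IsPeriodicPt, Function.IsFixedPt, ← Equiv.Perm.coe_pow, H.pow,
    e.injective.eq_iff]

theorem partialProduct_eq (H : Intertwines e h x y) (s : ℕ) (i : α) :
    partialProduct y s (e i) * h i = h ((x.right ^ s) i) * partialProduct x s i := by
  induction s with
  | zero => simp
  | succ s ih =>
    rw [partialProduct_succ, partialProduct_succ, mul_assoc, ih, H.pow, ← mul_assoc, H.left,
      pow_succ', Equiv.Perm.mul_apply, mul_assoc]

theorem mk_cycleProduct (H : Intertwines e h x y) (i : α) :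
    ConjClasses.mk (cycleProduct y (e i)) = ConjClasses.mk (cycleProduct x i) := by
  have hprod := H.partialProduct_eq (Function.minimalPeriod x.right i) i
  rw [pow_minimalPeriod_apply, ← H.minimalPeriod_eq, ← cycleProduct_eq_partialProduct,
    H.minimalPeriod_eq, ← cycleProduct_eq_partialProduct] at hprod
  exact (ConjClasses.mk_eq_mk_iff_isConj.2
    (isConj_iff.2 ⟨h i, mul_inv_eq_iff_eq_mul.2 hprod.symm⟩)).symm

theorem numCycles_eq (H : Intertwines e h x y) {r : ℕ} {c : ConjClasses Γ}
    (hrc : (r, c) = (1, 1) → Function.Surjective e) : numCycles y r c = numCycles x r c := by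
  unfold numCycles
  rw [← Set.ncard_image_of_injective _ (Set.image_injective.2 e.injective)]
  congr 1
  ext s
  constructor
  · rintro ⟨j, rfl, hr, hc⟩
    have hj : j ∈ Set.range e := by
      by_contra hj
      have hj' := H.notMem_supp j hj
      rw [setOf_sameCycle_of_notMem_supp hj', Set.ncard_singleton] at hr
      rw [cycleProduct_of_notMem_supp hj'] at hc
      exact hj (hrc (Prod.ext hr.symm hc.symm) j)
    obtain ⟨i, rfl⟩ := hj
    exact ⟨_, ⟨i, rfl, H.ncard_cycle i ▸ hr, H.mk_cycleProduct i ▸ hc⟩, H.image_cycle i⟩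
  · rintro ⟨s, ⟨i, rfl, hr, hc⟩, rfl⟩
    exact ⟨e i, H.image_cycle i, H.image_cycle i ▸ (H.ncard_cycle i).trans hr,
      (H.mk_cycleProduct i).trans hc⟩

theorem mem_supp_iff (H : Intertwines e h x y) {i : α} : e i ∈ supp y ↔ i ∈ supp x := by
  rw [← not_iff_not, WreathFH.notMem_supp, WreathFH.notMem_supp, H.right, e.injective.eq_iff]
  refine and_congr_right fun hi => ?_
  have hl := H.left i
  rw [hi] at hl
  constructor
  · intro hy
    rw [hy, one_mul] at hl
    exact mul_eq_left.1 hl.symm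
  · intro hx
    rw [hx, mul_one] at hl
    exact mul_eq_right.1 hl

theorem image_supp (H : Intertwines e h x y) : e '' supp x = supp y := by
  refine Set.Subset.antisymm (Set.image_subset_iff.2 fun i => H.mem_supp_iff.2) fun j hj => ?_
  obtain ⟨i, rfl⟩ : j ∈ Set.range e := not_not.1 fun h => H.notMem_supp j h hj
  exact ⟨i, H.mem_supp_iff.1 hj, rfl⟩

theorem symm {e : α ≃ β} (H : Intertwines e.toEmbedding h x y) :
    Intertwines e.symm.toEmbedding (fun j => (h (e.symm j))⁻¹) y x where
  right j := by
    obtain ⟨i, rfl⟩ := e.surjective j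
    have := H.right i
    simp only [Equiv.coe_toEmbedding] at this ⊢
    rw [this, e.symm_apply_apply, e.symm_apply_apply]
  left j := by
    obtain ⟨i, rfl⟩ := e.surjective j
    have hr := H.right i
    have hl := H.left i
    simp only [Equiv.coe_toEmbedding] at hr hl ⊢
    rw [hr, e.symm_apply_apply, e.symm_apply_apply, mul_inv_eq_iff_eq_mul, mul_assoc, hl,
      inv_mul_cancel_left]
  notMem_supp j hj := by simp at hj

theorem trans {e' : β ↪ γ} {h' : β → Γ} {z : Wreath Γ γ} (H : Intertwines e h x y)
    (H' : Intertwines e' h' y z) : Intertwines (e.trans e') (fun i => h' (e i) * h i) x z where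
  right i := by simp [H'.right, H.right]
  left i := by
    simp only [Function.Embedding.trans_apply]
    rw [← mul_assoc, H'.left, H.right, mul_assoc, H.left, mul_assoc]
  notMem_supp k hk := by
    rw [← H'.image_supp]
    rintro ⟨j, hj, rfl⟩
    refine H.notMem_supp j ?_ hj
    rintro ⟨i, rfl⟩
    exact hk ⟨i, rfl⟩

end Intertwines

theorem intertwines_conj (z x : Wreath Γ α) :
    Intertwines z.right.toEmbedding (fun i => z.left (z.right (x.right⁻¹ i))) x
      (z * x * z⁻¹) where
  right i := by simp
  left i := by
    have h : (z * x).right⁻¹ (z.right i) = x.right⁻¹ i := by simp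
    simp only [Equiv.coe_toEmbedding]
    rw [mul_left_apply, mul_left_apply, inv_left_apply, h]
    simp
  notMem_supp j hj := by simp at hj

theorem isConj_of_intertwines {e : α ≃ α} {h : α → Γ} {x y : Wreath Γ α}
    (H : Intertwines e.toEmbedding h x y) : IsConj x y := by
  refine isConj_iff.2 ⟨⟨fun j => h (x.right (e.symm j)), e⟩, ?_⟩
  rw [mul_inv_eq_iff_eq_mul]
  have hr (i : α) : y.right (e i) = e (x.right i) := H.right i
  have hl (i : α) : y.left (e i) * h i = h (x.right i) * x.left i := H.left i
  apply SemidirectProduct.ext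
  · funext j
    obtain ⟨i, rfl⟩ := e.surjective j
    have hinv : y.right⁻¹ (e i) = e (x.right⁻¹ i) := by
      rw [Equiv.Perm.inv_eq_iff_eq, hr]; simp
    rw [mul_left_apply, mul_left_apply]
    simp [hinv, hl]
  · ext i
    simp [hr]

/-- Conjugating `x` by its powers moves a point along its cycle. -/
theorem mk_cycleProduct_eq_of_sameCycle {x : Wreath Γ α} {i j : α} (h : x.right.SameCycle i j) :
    ConjClasses.mk (cycleProduct x j) = ConjClasses.mk (cycleProduct x i) := by
  obtain ⟨n, rfl⟩ := h
  have H := (intertwines_conj (x ^ n) x).mk_cycleProduct i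
  rw [((Commute.refl x).zpow_left n).eq, mul_inv_cancel_right] at H
  rwa [show x.right ^ n = (x ^ n).right from (map_zpow SemidirectProduct.rightHom x n).symm]

/-- The homomorphism `Γ ≀ Sym(α) → Γ ≀ Sym(β)` induced by an embedding of the index sets:
extension by trivial points. -/
def embedHom (Γ : Type*) [Group Γ] (e : α ↪ β) : Wreath Γ α →* Wreath Γ β where
  toFun x := ⟨Function.extend e x.left 1, Equiv.Perm.viaEmbeddingHom e x.right⟩
  map_one' := by
    apply SemidirectProduct.ext
    · exact Function.extend_one e
    · simp
  map_mul' x y := by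
    apply SemidirectProduct.ext
    · funext j
      rw [mul_left_apply]
      have hinv : (Equiv.Perm.viaEmbeddingHom e x.right)⁻¹ = x.right⁻¹.viaEmbedding e :=
        (map_inv (Equiv.Perm.viaEmbeddingHom e) x.right).symm
      simp only [hinv]
      by_cases h : ∃ i, e i = j
      · obtain ⟨i, rfl⟩ := h
        rw [Equiv.Perm.viaEmbedding_apply, e.injective.extend_apply, e.injective.extend_apply,
          e.injective.extend_apply, mul_left_apply]
      · rw [Equiv.Perm.viaEmbedding_apply_of_notMem _ _ _ h, Function.extend_apply' _ _ _ h,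
          Function.extend_apply' _ _ _ h, Function.extend_apply' _ _ _ h]
        simp
    · simp

theorem intertwines_embedHom (e : α ↪ β) (x : Wreath Γ α) :
    Intertwines e 1 x (embedHom Γ e x) where
  right i := Equiv.Perm.viaEmbedding_apply _ _ _
  left i := by simp [embedHom, e.injective.extend_apply]
  notMem_supp j hj := WreathFH.notMem_supp.2
    ⟨Equiv.Perm.viaEmbedding_apply_of_notMem _ _ _ hj, Function.extend_apply' _ _ _ hj⟩

theorem Intertwines.eq_embedHom {e : α ↪ β} {x : Wreath Γ α} {y : Wreath Γ β}
    (H : Intertwines e 1 x y) : y = embedHom Γ e x := by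
  have H' := intertwines_embedHom e x
  have hl {z : Wreath Γ β} (Hz : Intertwines e 1 x z) (i : α) : z.left (e i) = x.left i := by
    simpa using Hz.left i
  apply SemidirectProduct.ext
  · funext j
    by_cases h : j ∈ Set.range e
    · obtain ⟨i, rfl⟩ := h
      rw [hl H, hl H']
    · rw [(WreathFH.notMem_supp.1 (H.notMem_supp j h)).2,
        (WreathFH.notMem_supp.1 (H'.notMem_supp j h)).2]
  · ext j
    by_cases h : j ∈ Set.range e
    · obtain ⟨i, rfl⟩ := h
      rw [H.right, H'.right]
    · rw [(WreathFH.notMem_supp.1 (H.notMem_supp j h)).1,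
        (WreathFH.notMem_supp.1 (H'.notMem_supp j h)).1]

theorem embedHom_injective (e : α ↪ β) : Function.Injective (embedHom Γ e) := by
  intro x y hxy
  have hl (z : Wreath Γ α) (i : α) : (embedHom Γ e z).left (e i) = z.left i := by
    simpa using (intertwines_embedHom e z).left i
  have hr (z : Wreath Γ α) (i : α) : (embedHom Γ e z).right (e i) = e (z.right i) :=
    (intertwines_embedHom e z).right i
  apply SemidirectProduct.ext
  · funext i
    rw [← hl, hxy, hl]
  · ext i
    exact e.injective (by rw [← hr, hxy, hr])

theorem right_apply_mem_iff {y : Wreath Γ β} {S : Set β} (h : supp y ⊆ S) (j : β) :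
    y.right j ∈ S ↔ j ∈ S := by
  by_cases hj : y.right j = j
  · rw [hj]
  · exact iff_of_true (h (Or.inl fun h' => hj (y.right.injective h'))) (h (Or.inl hj))

theorem exists_embedHom_eq (e : α ↪ β) {y : Wreath Γ β} (h : supp y ⊆ Set.range e) :
    ∃ x, embedHom Γ e x = y := by
  let f : α ≃ Set.range e := Equiv.ofInjective e e.injective
  have hf (j : Set.range e) : e (f.symm j) = j := Equiv.apply_ofInjective_symm e.injective j
  refine ⟨⟨fun i => y.left (e i),
    f.symm.permCongr (y.right.subtypePerm (p := (· ∈ Set.range e)) (right_apply_mem_iff h))⟩, ?_⟩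
  refine (Intertwines.eq_embedHom ⟨fun i => ?_, fun i => by simp, fun j hj h' => hj (h h')⟩).symm
  simp only [Equiv.permCongr_apply, hf]
  rfl

theorem extend_eq_embedHom (n : ℕ) (x : WreathFin Γ n) :
    extend Γ n x = embedHom Γ Fin.valEmbedding x := by
  refine Intertwines.eq_embedHom ⟨fun i => ?_, fun i => ?_, fun j hj => ?_⟩
  · exact Equiv.Perm.extendDomain_apply_image x.right Fin.equivSubtype i
  · simp [extend]
  · have h : ¬ j < n := fun h => hj ⟨⟨j, h⟩, rfl⟩
    exact notMem_supp.2
      ⟨Equiv.Perm.extendDomain_apply_not_subtype x.right Fin.equivSubtype h, dif_neg h⟩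

/-- The product of disjoint cycles of lengths `k i` with cycle-products `p i`: the normal form of an
element up to relabelling. The cycle of index `i` runs through `ZMod (k i)`, which is infinite for
`k i = 0`, and carries `p i` at its last point `-1`. -/
def model (k : ι → ℕ) (p : ι → Γ) : Wreath Γ (Σ i, ZMod (k i)) :=
  ⟨fun j => if j.2 + 1 = 0 then p j.1 else 1,
    Equiv.sigmaCongrRight fun _ => Equiv.addRight 1⟩

section Model

variable (k : ι → ℕ) (p : ι → Γ)

theorem model_right (i : ι) (s : ZMod (k i)) : (model k p).right ⟨i, s⟩ = ⟨i, s + 1⟩ := rfl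

theorem model_left (i : ι) (s : ZMod (k i)) :
    (model k p).left ⟨i, s⟩ = if s + 1 = 0 then p i else 1 := rfl

theorem model_right_pow (i : ι) (s : ZMod (k i)) (n : ℕ) :
    ((model k p).right ^ n) ⟨i, s⟩ = ⟨i, s + n⟩ := by
  induction n with
  | zero => simp
  | succ n ih =>
    rw [pow_succ', Equiv.Perm.mul_apply, ih, model_right, Nat.cast_succ, add_assoc]

theorem model_right_zpow (i : ι) (s : ZMod (k i)) (n : ℤ) :
    ((model k p).right ^ n) ⟨i, s⟩ = ⟨i, s + n⟩ := by
  cases n with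
  | ofNat n => simpa using model_right_pow k p i s n
  | negSucc n =>
    rw [zpow_negSucc, Equiv.Perm.inv_eq_iff_eq, model_right_pow]
    simp [Int.negSucc_eq, add_assoc]

theorem model_setOf_sameCycle (j : Σ i, ZMod (k i)) :
    {j' | (model k p).right.SameCycle j j'} = Set.range (Sigma.mk j.1) := by
  obtain ⟨i, s⟩ := j
  ext j'
  constructor
  · rintro ⟨n, rfl⟩
    exact ⟨s + n, (model_right_zpow k p i s n).symm⟩
  · rintro ⟨t, rfl⟩
    obtain ⟨n, hn⟩ := ZMod.intCast_surjective (t - s)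
    exact ⟨n, by rw [model_right_zpow, hn, add_sub_cancel]⟩

theorem model_minimalPeriod (j : Σ i, ZMod (k i)) :
    Function.minimalPeriod (model k p).right j = k j.1 := by
  obtain ⟨i, s⟩ := j
  have periodic_iff (n : ℕ) :
      Function.IsPeriodicPt (model k p).right n ⟨i, s⟩ ↔ k i ∣ n := by
    rw [Function.IsPeriodicPt, Function.IsFixedPt, ← Equiv.Perm.coe_pow, model_right_pow,
      ← ZMod.natCast_eq_zero_iff]
    simp
  apply Nat.dvd_antisymm
  · rw [← Function.isPeriodicPt_iff_minimalPeriod_dvd, periodic_iff]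
  · rw [← periodic_iff]
    exact Function.isPeriodicPt_minimalPeriod _ _

theorem model_partialProduct_of_lt (i : ι) {s : ℕ} (hs : s < k i) :
    partialProduct (model k p) s ⟨i, 0⟩ = 1 := by
  induction s with
  | zero => simp
  | succ s ih =>
    rw [partialProduct_succ, ih (Nat.lt_of_succ_lt hs), model_right_pow, model_left, if_neg,
      mul_one]
    rw [zero_add, ← Nat.cast_succ, ZMod.natCast_eq_zero_iff]
    exact Nat.not_dvd_of_pos_of_lt (Nat.succ_pos s) hs

theorem model_cycleProduct_zero (i : ι) [NeZero (k i)] : cycleProduct (model k p) ⟨i, 0⟩ = p i := by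
  obtain ⟨m, hm⟩ := Nat.exists_eq_succ_of_ne_zero (NeZero.ne (k i))
  rw [cycleProduct_eq_partialProduct, model_minimalPeriod]
  simp only [hm]
  rw [partialProduct_succ, model_partialProduct_of_lt k p i (hm ▸ m.lt_succ_self), model_right_pow,
    model_left, if_pos, mul_one]
  rw [zero_add, ← Nat.cast_succ, ZMod.natCast_eq_zero_iff, hm]

theorem model_mk_cycleProduct (j : Σ i, ZMod (k i)) [NeZero (k j.1)] :
    ConjClasses.mk (cycleProduct (model k p) j) = ConjClasses.mk (p j.1) := by
  rw [← model_cycleProduct_zero k p j.1]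
  refine mk_cycleProduct_eq_of_sameCycle ?_
  change j ∈ {j' | (model k p).right.SameCycle ⟨j.1, 0⟩ j'}
  exact model_setOf_sameCycle k p ⟨j.1, 0⟩ ▸ ⟨j.2, rfl⟩

theorem numCycles_model [∀ i, NeZero (k i)] (r : ℕ) (c : ConjClasses Γ) :
    numCycles (model k p) r c = {i | k i = r ∧ ConjClasses.mk (p i) = c}.ncard := by
  have hinj : Function.Injective fun i => Set.range (Sigma.mk (β := fun i => ZMod (k i)) i) := by
    intro i i' h
    obtain ⟨t, ht⟩ : (⟨i, 0⟩ : Σ i, ZMod (k i)) ∈ Set.range (Sigma.mk i') :=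
      Set.ext_iff.1 h _ |>.1 ⟨0, rfl⟩
    exact (congrArg Sigma.fst ht).symm
  have hcard (i : ι) : (Set.range (Sigma.mk (β := fun i => ZMod (k i)) i)).ncard = k i := by
    rw [← Set.image_univ, Set.ncard_image_of_injective _ sigma_mk_injective, Set.ncard_univ,
      Nat.card_zmod]
  rw [← Set.ncard_image_of_injective _ hinj, numCycles]
  congr 1
  ext s
  simp only [model_setOf_sameCycle, model_mk_cycleProduct]
  constructor
  · rintro ⟨j, rfl, hr, hc⟩
    exact ⟨j.1, ⟨(hcard _).symm.trans hr, hc⟩, rfl⟩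
  · rintro ⟨i, ⟨hr, hc⟩, rfl⟩
    exact ⟨⟨i, 0⟩, rfl, (hcard i).trans hr, hc⟩

end Model

theorem exists_intertwines_model_model {k : ι → ℕ} {p : ι → Γ} {k' : κ → ℕ} {p' : κ → Γ}
    (f : ι ≃ κ) (hk : ∀ i, k' (f i) = k i) (hp : ∀ i, IsConj (p i) (p' (f i))) :
    ∃ (e : (Σ i, ZMod (k i)) ≃ Σ i, ZMod (k' i)) (h : (Σ i, ZMod (k i)) → Γ),
      Intertwines e.toEmbedding h (model k p) (model k' p') := by
  obtain rfl : k = k' ∘ f := funext fun i => (hk i).symm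
  choose u hu using fun i => isConj_iff.1 (hp i)
  refine ⟨Equiv.sigmaCongrLeft (β := fun i => ZMod (k' i)) f, fun j => u j.1, ?_, ?_, ?_⟩
  · rintro ⟨i, s⟩; rfl
  · rintro ⟨i, s⟩
    change (if s + 1 = 0 then p' (f i) else 1) * u i = u i * if s + 1 = 0 then p i else 1
    rw [← hu i]
    split_ifs <;> simp
  · intro j hj; simp at hj

theorem exists_cycleCoordinates {α : Type u} (σ : Equiv.Perm α) :
    ∃ (ι : Type u) (b : ι → α) (e : (Σ i, ZMod (Function.minimalPeriod σ (b i))) ≃ α),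
      ∀ (i : ι) (n : ℤ), e ⟨i, n⟩ = (σ ^ n) (b i) := by
  refine ⟨MulAction.orbitRel.Quotient (Subgroup.zpowers σ) α, Quotient.out,
    ((MulAction.selfEquivSigmaOrbits (Subgroup.zpowers σ) α).trans
      (Equiv.sigmaCongrRight fun q => MulAction.orbitZPowersEquiv σ q.out)).symm, fun q n => ?_⟩
  change (((MulAction.orbitZPowersEquiv σ q.out).symm n : MulAction.orbit _ _) : α) = _
  rw [MulAction.orbitZPowersEquiv_symm_apply']
  rfl

theorem exists_intertwines_model {α : Type u} [Finite α] (x : Wreath Γ α) :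
    ∃ (ι : Type u) (k : ι → ℕ) (p : ι → Γ) (e : (Σ i, ZMod (k i)) ≃ α)
      (h : (Σ i, ZMod (k i)) → Γ),
      (∀ i, NeZero (k i)) ∧ Intertwines e.toEmbedding h (model k p) x := by
  obtain ⟨ι, b, e, he⟩ := exists_cycleCoordinates x.right
  have hpos (i : ι) : NeZero (Function.minimalPeriod x.right (b i)) :=
    ⟨(Function.minimalPeriod_pos_of_mem_periodicPts
      (x.right.injective.mem_periodicPts (b i))).ne'⟩
  have he_nat (i : ι) (n : ℕ) : e ⟨i, (n : ZMod _)⟩ = (x.right ^ n) (b i) := by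
    rw [← zpow_natCast, ← he, Int.cast_natCast]
  refine ⟨ι, _, fun i => cycleProduct x (b i), e, fun j => partialProduct x j.2.val (b j.1), hpos,
    ?_, ?_, fun j hj => by simp at hj⟩
  · rintro ⟨i, s⟩
    obtain ⟨n, rfl⟩ := ZMod.natCast_zmod_surjective s
    rw [model_right, ← Nat.cast_succ]
    simp only [Equiv.coe_toEmbedding, he_nat, pow_succ', Equiv.Perm.mul_apply]
  · rintro ⟨i, s⟩
    have hstep : x.left (e ⟨i, s⟩) * partialProduct x s.val (b i) =
        partialProduct x (s.val + 1) (b i) := by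
      rw [partialProduct_succ, ← he_nat, ZMod.natCast_zmod_val]
    refine hstep.trans ?_
    rw [model_left, model_right]
    rcases (Nat.succ_le_of_lt (ZMod.val_lt s)).lt_or_eq with hlt | hlast
    · have hs : (s + 1).val = s.val + 1 := by
        rw [← ZMod.natCast_zmod_val s, ← Nat.cast_succ, ZMod.val_cast_of_lt hlt,
          ZMod.natCast_zmod_val]
      rw [if_neg (fun h0 => by simp [h0] at hs), mul_one, hs]
    · have hs : s + 1 = 0 := by
        rw [← ZMod.natCast_zmod_val s, ← Nat.cast_succ, hlast, ZMod.natCast_self]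
      rw [if_pos hs, hs, ZMod.val_zero, partialProduct_zero, one_mul,
        cycleProduct_eq_partialProduct]
      exact congrArg (partialProduct x · (b i)) hlast

open Classical in
/-- The length of the cycles with cycle-product in `c` that contribute the part `r` to a modified
type. -/
def cycleLength (c : ConjClasses Γ) (r : ℕ+) : ℕ := if c = 1 then r + 1 else r

theorem mk_eq_one_iff {g : Γ} : ConjClasses.mk g = 1 ↔ g = 1 := by
  rw [ConjClasses.one_eq_mk_one, ConjClasses.mk_eq_mk_iff_isConj, isConj_one_left]

theorem cycleLength_one (r : ℕ+) : cycleLength (1 : ConjClasses Γ) r = r + 1 := if_pos rfl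

theorem cycleLength_of_ne_one {c : ConjClasses Γ} (hc : c ≠ 1) (r : ℕ+) : cycleLength c r = r :=
  if_neg hc

theorem cycleLength_injective (c : ConjClasses Γ) : Function.Injective (cycleLength c) := by
  intro r s h
  unfold cycleLength at h
  split_ifs at h
  · exact PNat.eq (Nat.succ_injective h)
  · exact PNat.eq h

theorem cycleLength_ne_zero (c : ConjClasses Γ) (r : ℕ+) : cycleLength c r ≠ 0 := by
  unfold cycleLength
  split_ifs
  · exact Nat.succ_ne_zero _
  · exact r.ne_zero

theorem cycleLength_pair_ne (c : ConjClasses Γ) (r : ℕ+) : (cycleLength c r, c) ≠ (1, 1) := by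
  intro h
  obtain ⟨hr, rfl⟩ := Prod.mk.injEq _ _ _ _ ▸ h
  rw [cycleLength_one] at hr
  exact r.ne_zero (Nat.succ_injective hr)

theorem exists_cycleLength_eq {n : ℕ} {c : ConjClasses Γ} (hn : n ≠ 0) (h : (n, c) ≠ (1, 1)) :
    ∃ r, cycleLength c r = n := by
  by_cases hc : c = 1
  · subst hc
    obtain ⟨m, rfl⟩ := Nat.exists_eq_succ_of_ne_zero hn
    have hm : m ≠ 0 := by rintro rfl; exact h rfl
    exact ⟨⟨m, Nat.pos_of_ne_zero hm⟩, cycleLength_one _⟩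
  · exact ⟨⟨n, Nat.pos_of_ne_zero hn⟩, cycleLength_of_ne_one hc _⟩

theorem hasModType_iff_numCycles {x : Wreath Γ α} {ν : ModType Γ} :
    HasModType x ν ↔ ∀ c r, (ν c).count r = numCycles x (cycleLength c r) c := by
  constructor
  · rintro ⟨hone, hne⟩ c r
    by_cases hc : c = 1
    · subst hc; rw [cycleLength_one]; exact hone r
    · rw [cycleLength_of_ne_one hc]; exact hne c hc r
  · intro h
    exact ⟨fun r => cycleLength_one (Γ := Γ) r ▸ h 1 r,
      fun c hc r => cycleLength_of_ne_one hc r ▸ h c r⟩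

theorem HasModType.unique {x : Wreath Γ α} {ν ν' : ModType Γ} (h : HasModType x ν)
    (h' : HasModType x ν') : ν = ν' := by
  rw [hasModType_iff_numCycles] at h h'
  funext c
  ext r
  rw [h, h']

theorem Intertwines.hasModType_iff {e : α ↪ β} {h : α → Γ} {x : Wreath Γ α} {y : Wreath Γ β}
    (H : Intertwines e h x y) (ν : ModType Γ) : HasModType y ν ↔ HasModType x ν := by
  simp only [hasModType_iff_numCycles,
    H.numCycles_eq (fun hrc => absurd hrc (cycleLength_pair_ne _ _))]

theorem numCycles_zero [Finite α] (x : Wreath Γ α) (c : ConjClasses Γ) : numCycles x 0 c = 0 := by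
  refine (Set.ncard_eq_zero (Set.toFinite _)).2 (Set.eq_empty_of_forall_notMem ?_)
  rintro _ ⟨i, rfl, hcard, -⟩
  exact ((Set.ncard_eq_zero (Set.toFinite _)).1 hcard).le (Equiv.Perm.SameCycle.refl _ i)

theorem numCycles_eq_zero_of_card_lt [Finite α] (x : Wreath Γ α) {n : ℕ} (hn : Nat.card α < n)
    (c : ConjClasses Γ) : numCycles x n c = 0 := by
  refine (Set.ncard_eq_zero (Set.toFinite _)).2 (Set.eq_empty_of_forall_notMem ?_)
  rintro s ⟨i, -, rfl, -⟩
  exact (Set.ncard_le_card s).not_gt hn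

theorem numCycles_one_one (x : Wreath Γ α) : numCycles x 1 1 = (supp x)ᶜ.ncard := by
  rw [← Set.ncard_image_of_injective _ Set.singleton_injective, numCycles]
  congr 1
  ext s
  constructor
  · rintro ⟨i, rfl, hcard, hprod⟩
    obtain ⟨j, hj⟩ := Set.ncard_eq_one.1 hcard
    have hcycle : ∀ j', x.right.SameCycle i j' → j' = i := fun j' hj' =>
      (hj.le hj' : j' = j).trans (hj.le (Equiv.Perm.SameCycle.refl _ i) : i = j).symm
    have hfix : x.right i = i := hcycle _ ⟨1, rfl⟩
    have hone : cycleProduct x i = 1 := by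
      rwa [← mk_eq_one_iff]
    rw [cycleProduct_eq_partialProduct, Function.minimalPeriod_eq_one_iff_isFixedPt.2
      (show Function.IsFixedPt x.right i from hfix), partialProduct_succ] at hone
    have hi : i ∉ supp x := notMem_supp.2 ⟨hfix, by simpa using hone⟩
    exact ⟨i, hi, (setOf_sameCycle_of_notMem_supp hi).symm⟩
  · rintro ⟨i, hi, rfl⟩
    refine ⟨i, (setOf_sameCycle_of_notMem_supp hi).symm, Set.ncard_singleton i, ?_⟩
    rw [cycleProduct_of_notMem_supp hi]
    rfl

theorem exists_hasModType [Finite α] (x : Wreath Γ α) : ∃ ν, HasModType x ν := by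
  have hfin (c : ConjClasses Γ) :
      (Function.support fun r : ℕ+ => numCycles x (cycleLength c r) c).Finite :=
    ((Set.finite_Iic (Nat.card α)).preimage (cycleLength_injective c).injOn).subset fun r hr =>
      not_lt.1 fun h => hr (numCycles_eq_zero_of_card_lt x h c)
  refine ⟨fun c => Finsupp.toMultiset (Finsupp.ofSupportFinite _ (hfin c)),
    hasModType_iff_numCycles.2 fun c r => ?_⟩
  rw [Finsupp.count_toMultiset, Finsupp.ofSupportFinite_coe]

section Lengths

variable [Fintype ι] {k : ι → ℕ} {p : ι → Γ} [∀ i, NeZero (k i)] {ν : ModType Γ}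

open Classical in
theorem count_model_lengths (n : ℕ) (c : ConjClasses Γ) :
    ((Finset.univ.filter fun i => ConjClasses.mk (p i) = c).val.map k).count n =
      numCycles (model k p) n c := by
  rw [numCycles_model, Multiset.count_map, Set.ncard_eq_toFinset_card', Set.toFinset_ofPred,
    ← Finset.filter_val, Finset.filter_filter, ← Finset.card_def]
  congr 1
  ext i
  simp only [Finset.mem_filter, Finset.mem_univ, true_and, and_comm, eq_comm]

open Classical in
theorem HasModType.model_lengths (h : HasModType (model k p) ν) (c : ConjClasses Γ) :
    (Finset.univ.filter fun i => ConjClasses.mk (p i) = c).val.map k =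
      (ν c).map (cycleLength c) +
        Multiset.replicate (if c = 1 then numCycles (model k p) 1 1 else 0) 1 := by
  have hcount := hasModType_iff_numCycles.1 h
  ext n
  rw [count_model_lengths, Multiset.count_add, Multiset.count_replicate]
  by_cases hpair : (n, c) = (1, 1)
  · obtain ⟨rfl, rfl⟩ := Prod.mk.injEq _ _ _ _ ▸ hpair
    have : Multiset.count 1 ((ν 1).map (cycleLength (1 : ConjClasses Γ))) = 0 := by
      rw [Multiset.count_eq_zero, Multiset.mem_map]
      rintro ⟨r, -, hr⟩
      exact cycleLength_pair_ne 1 r (by rw [hr])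
    simp [this]
  · have hzero : (if 1 = n then if c = 1 then numCycles (model k p) 1 1 else 0 else 0) = 0 := by
      split_ifs with h1 hc
      · exact absurd (Prod.ext h1.symm hc) hpair
      all_goals rfl
    rw [hzero, add_zero]
    rcases eq_or_ne n 0 with rfl | hn
    · rw [← count_model_lengths, Multiset.count_eq_zero.2, Multiset.count_eq_zero.2]
      · simp [cycleLength_ne_zero]
      · simp [NeZero.ne]
    · obtain ⟨r, rfl⟩ := exists_cycleLength_eq hn hpair
      rw [Multiset.count_map_eq_count' _ _ (cycleLength_injective c), hcount]

open Classical in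
theorem HasModType.card_model_trivial (h : HasModType (model k p) ν) :
    (Finset.univ.filter fun i => p i = 1).card = (ν 1).card + numCycles (model k p) 1 1 := by
  have := congrArg Multiset.card (h.model_lengths 1)
  simpa [mk_eq_one_iff, Finset.card_def] using this

open Classical in
theorem HasModType.sum_parts_add (h : HasModType (model k p) ν) (c : ConjClasses Γ) :
    ((ν c).map fun r : ℕ+ => (r : ℕ)).sum +
        (Finset.univ.filter fun i => ConjClasses.mk (p i) = c ∧ p i = 1).card =
      ∑ i with ConjClasses.mk (p i) = c, k i := by
  have hsum : ∑ i with ConjClasses.mk (p i) = c, k i = _ :=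
    congrArg Multiset.sum (h.model_lengths c)
  rw [hsum]
  by_cases hc : c = 1
  · subst hc
    simp only [mk_eq_one_iff, and_self, h.card_model_trivial, cycleLength_one,
      Multiset.sum_map_add, Multiset.sum_add, if_pos, Multiset.sum_replicate, Multiset.map_const',
      smul_eq_mul, mul_one, add_assoc]
  · have hempty : (Finset.univ.filter fun i => ConjClasses.mk (p i) = c ∧ p i = 1) = ∅ :=
      Finset.filter_eq_empty_iff.2 fun i _ hi => hc (hi.1 ▸ mk_eq_one_iff.2 hi.2)
    simp [hempty, cycleLength_of_ne_one hc, hc]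

open Classical in
theorem HasModType.degree_add_card_model_trivial (h : HasModType (model k p) ν) :
    degree ν + (Finset.univ.filter fun i => p i = 1).card = ∑ i, k i := by
  have hmaps (i : ι) (_ : i ∈ (Finset.univ : Finset ι)) :
      ConjClasses.mk (p i) ∈ Finset.univ.image fun i => ConjClasses.mk (p i) :=
    Finset.mem_image_of_mem _ (Finset.mem_univ i)
  have hdegree : degree ν = ∑ c ∈ Finset.univ.image fun i => ConjClasses.mk (p i),
      ((ν c).map fun r : ℕ+ => (r : ℕ)).sum := by
    refine finsum_eq_sum_of_support_subset _ fun c hc => ?_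
    by_contra hc'
    have hempty : (Finset.univ.filter fun i => ConjClasses.mk (p i) = c) = ∅ :=
      Finset.filter_eq_empty_iff.2 fun i hi hic => hc' (hic ▸ hmaps i hi)
    have hsum := h.sum_parts_add c
    rw [hempty, Finset.sum_empty] at hsum
    exact hc (Nat.eq_zero_of_add_eq_zero_right hsum)
  rw [hdegree, Finset.card_eq_sum_card_fiberwise (f := fun i => ConjClasses.mk (p i))
    (fun i _ => hmaps i (Finset.mem_univ i)), ← Finset.sum_add_distrib,
    ← Finset.sum_fiberwise_of_maps_to hmaps]
  refine Finset.sum_congr rfl fun c _ => ?_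
  rw [← h.sum_parts_add, Finset.filter_filter]
  simp only [and_comm]

end Lengths

/-- The number of points moved by the elements of modified type `ν`. -/
def supportSize (ν : ModType Γ) : ℕ := degree ν + (ν 1).card

theorem Intertwines.ncard_supp {e : α ↪ β} {h : α → Γ} {x : Wreath Γ α} {y : Wreath Γ β}
    (H : Intertwines e h x y) : (supp y).ncard = (supp x).ncard := by
  rw [← H.image_supp, Set.ncard_image_of_injective _ e.injective]

theorem HasModType.ncard_supp_model [Finite ι] {k : ι → ℕ} {p : ι → Γ} [∀ i, NeZero (k i)]
    {ν : ModType Γ} (h : HasModType (model k p) ν) :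
    (supp (model k p)).ncard = supportSize ν := by
  classical
  have := Fintype.ofFinite ι
  have hcard : (supp (model k p)).ncard + numCycles (model k p) 1 1 = ∑ i, k i := by
    rw [numCycles_one_one, Set.ncard_add_ncard_compl, Nat.card_sigma]
    simp
  have hdegree := h.degree_add_card_model_trivial
  rw [h.card_model_trivial, ← add_assoc] at hdegree
  exact Nat.add_right_cancel (hcard.trans hdegree.symm)

theorem finite_of_sigma_equiv [Finite α] {k : ι → ℕ} (e : (Σ i, ZMod (k i)) ≃ α) : Finite ι :=
  Finite.of_injective (fun i => e ⟨i, 0⟩) fun _ _ h => congrArg Sigma.fst (e.injective h)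

theorem HasModType.ncard_supp {x : Wreath Γ α} {ν : ModType Γ} (h : HasModType x ν)
    (hx : (supp x).Finite) : (supp x).ncard = supportSize ν := by
  obtain ⟨n, f, hf⟩ := hx.fin_embedding
  obtain ⟨y, rfl⟩ := exists_embedHom_eq f hf.ge
  obtain ⟨ι, k, p, e, s, _, H⟩ := exists_intertwines_model y
  have := finite_of_sigma_equiv e
  have := Fintype.ofFinite ι
  rw [(intertwines_embedHom f y).hasModType_iff, H.hasModType_iff] at h
  rw [(intertwines_embedHom f y).ncard_supp, H.ncard_supp, h.ncard_supp_model]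

theorem HasModType.numCycles_eq [Finite α] {x y : Wreath Γ α} {ν : ModType Γ}
    (hx : HasModType x ν) (hy : HasModType y ν) (n : ℕ) (c : ConjClasses Γ) :
    numCycles x n c = numCycles y n c := by
  by_cases hpair : (n, c) = (1, 1)
  · obtain ⟨rfl, rfl⟩ := Prod.mk.injEq _ _ _ _ ▸ hpair
    rw [numCycles_one_one, numCycles_one_one, Set.ncard_compl, Set.ncard_compl,
      hx.ncard_supp (Set.toFinite _), hy.ncard_supp (Set.toFinite _)]
  rcases eq_or_ne n 0 with rfl | hn
  · rw [numCycles_zero, numCycles_zero]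
  · obtain ⟨r, rfl⟩ := exists_cycleLength_eq hn hpair
    rw [← hasModType_iff_numCycles.1 hx, ← hasModType_iff_numCycles.1 hy]

theorem exists_equiv_of_ncard_fibers_eq {δ : Type*} [Finite ι] [Finite κ] {f : ι → δ} {g : κ → δ}
    (h : ∀ d, {i | f i = d}.ncard = {j | g j = d}.ncard) : ∃ e : ι ≃ κ, ∀ i, g (e i) = f i := by
  have fiberEquiv (d : δ) : Nonempty ({i // f i = d} ≃ {j // g j = d}) :=
    Finite.card_eq.1 (h d)
  exact ⟨Equiv.ofFiberEquiv fun d => (fiberEquiv d).some, Equiv.ofFiberEquiv_map _⟩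

theorem HasModType.isConj [Finite α] {x y : Wreath Γ α} {ν : ModType Γ} (hx : HasModType x ν)
    (hy : HasModType y ν) : IsConj x y := by
  obtain ⟨ι, k, p, e, s, _, H⟩ := exists_intertwines_model x
  obtain ⟨κ, k', p', e', s', _, H'⟩ := exists_intertwines_model y
  have := finite_of_sigma_equiv e
  have := finite_of_sigma_equiv e'
  obtain ⟨f, hf⟩ := exists_equiv_of_ncard_fibers_eq (f := fun i => (k i, ConjClasses.mk (p i)))
    (g := fun j => (k' j, ConjClasses.mk (p' j))) fun ⟨n, c⟩ => by
      simp only [Prod.mk.injEq]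
      rw [← numCycles_model, ← numCycles_model, ← H.numCycles_eq fun _ => e.surjective,
        ← H'.numCycles_eq fun _ => e'.surjective, hx.numCycles_eq hy]
  simp only [Prod.mk.injEq] at hf
  obtain ⟨e'', s'', H''⟩ := exists_intertwines_model_model (p := p) (p' := p') f
    (fun i => (hf i).1) fun i => ConjClasses.mk_eq_mk_iff_isConj.1 (hf i).2.symm
  exact isConj_of_intertwines (e := e.symm.trans (e''.trans e')) (H.symm.trans (H''.trans H'))

theorem exists_hasModType_fin [Finite (ConjClasses Γ)] (ν : ModType Γ) {n : ℕ}
    (hn : supportSize ν ≤ n) : ∃ x : WreathFin Γ n, HasModType x ν := by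
  classical
  have := Fintype.ofFinite (ConjClasses Γ)
  let k (j : Σ c, (ν c).ToType) : ℕ := cycleLength j.1 j.2.1
  let p (j : Σ c, (ν c).ToType) : Γ := Quotient.out j.1
  have hp (j) : ConjClasses.mk (p j) = j.1 := Quotient.out_eq j.1
  have hk (j) : NeZero (k j) := ⟨cycleLength_ne_zero _ _⟩
  have hν : HasModType (model k p) ν := by
    refine hasModType_iff_numCycles.2 fun c r => ?_
    have hset : {j | k j = cycleLength c r ∧ ConjClasses.mk (p j) = c} =
        Sigma.mk c '' {t : (ν c).ToType | t.1 = r} := by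
      ext ⟨d, t⟩
      simp only [hp, Set.mem_ofPred_eq, Set.mem_image]
      constructor
      · rintro ⟨hlength, rfl⟩
        exact ⟨t, cycleLength_injective _ hlength, rfl⟩
      · rintro ⟨t, rfl, ⟨⟩⟩
        exact ⟨rfl, rfl⟩
    rw [numCycles_model, hset, Set.ncard_image_of_injective _ sigma_mk_injective]
    have fiberEquiv : {t : (ν c).ToType // t.1 = r} ≃ Fin ((ν c).count r) :=
      Equiv.sigmaSubtype (α := ℕ+) (β := fun r => Fin ((ν c).count r)) r
    exact ((Nat.card_congr fiberEquiv).trans (Nat.card_fin _)).symm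
  have hfull : supp (model k p) = Set.univ := by
    rw [← Set.compl_empty_iff, ← Set.ncard_eq_zero (Set.toFinite _), ← numCycles_one_one,
      numCycles_model, Set.ncard_eq_zero (Set.toFinite _)]
    refine Set.eq_empty_of_forall_notMem fun j hj => cycleLength_pair_ne j.1 j.2.1 ?_
    exact Prod.ext hj.1 ((hp j).symm.trans hj.2)
  have hcard : Fintype.card (Σ j, ZMod (k j)) ≤ Fintype.card (Fin n) := by
    rwa [← Nat.card_eq_fintype_card, ← Set.ncard_univ, ← hfull, hν.ncard_supp_model,
      Fintype.card_fin]
  obtain ⟨e⟩ := Function.Embedding.nonempty_of_card_le hcard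
  exact ⟨embedHom Γ e (model k p), ((intertwines_embedHom e _).hasModType_iff ν).2 hν⟩

/-- The equation `a φ(i) = b φ(j)` in an unknown function `φ : α → G`. -/
structure MonomialEquation (α G : Type*) where
  i : α
  j : α
  a : G
  b : G

namespace MonomialEquation

variable {G : Type*}

/-- The functions that satisfy all the equations of a finite system. -/
def solutions [Mul G] (E : List (MonomialEquation α G)) : Set (α → G) :=
  {φ | ∀ t ∈ E, t.a * φ t.i = t.b * φ t.j}

/-- The equation in `ψ` obtained by substituting `φ(v) = c(v) ψ(f(v))`. -/
def subst [Mul G] (f : α → β) (c : α → G) (t : MonomialEquation α G) : MonomialEquation β G :=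
  ⟨f t.i, f t.j, t.a * c t.i, t.b * c t.j⟩

theorem solutions_append [Mul G] (E F : List (MonomialEquation α G)) :
    solutions (E ++ F) = solutions E ∩ solutions F := by
  ext φ
  simp only [solutions, List.mem_append, Set.mem_inter_iff, Set.mem_ofPred_eq, or_imp, forall_and]

theorem mem_solutions_map_subst [Semigroup G] {f : α → β} {c : α → G}
    {E : List (MonomialEquation α G)} {ψ : β → G} :
    ψ ∈ solutions (E.map (subst f c)) ↔ (fun v => c v * ψ (f v)) ∈ solutions E := by
  simp only [solutions, subst, List.forall_mem_map, Set.mem_ofPred_eq, mul_assoc]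

/-- Either the equation expresses `φ(v)` through another value of `φ`, or it is implied by
`φ(v) = 0`, or it is trivial; hence it eliminates the variable `φ(v)`. -/
theorem exists_elimination [GroupWithZero G] [Nontrivial α] (t : MonomialEquation α G) :
    ∃ (v : α) (f : α → {w // w ≠ v}) (c : α → G),
      Function.Injective (fun (ψ : {w // w ≠ v} → G) w => c w * ψ (f w)) ∧
      ∀ ψ : {w // w ≠ v} → G, (fun w => c w * ψ (f w)) ∈ solutions [t] := by
  classical
  simp only [solutions, List.forall_mem_singleton, Set.mem_ofPred_eq]
  suffices h : ∃ (v : α) (w : {w // w ≠ v}) (d : G), ∀ ψ : {w // w ≠ v} → G,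
      t.a * ((if t.i = v then d else 1) * ψ (if h : t.i ≠ v then ⟨t.i, h⟩ else w)) =
        t.b * ((if t.j = v then d else 1) * ψ (if h : t.j ≠ v then ⟨t.j, h⟩ else w)) by
    obtain ⟨v, w, d, h⟩ := h
    refine ⟨v, fun u => if h : u ≠ v then ⟨u, h⟩ else w, fun u => if u = v then d else 1, ?_, h⟩
    intro ψ ψ' hψ
    funext u
    simpa [u.2] using congrFun hψ u.1
  by_cases ha : t.a = 0
  · obtain ⟨w, hw⟩ := exists_ne t.j
    exact ⟨t.j, ⟨w, hw⟩, 0, fun ψ => by simp [ha]⟩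
  by_cases hij : t.i = t.j
  · obtain ⟨w, hw⟩ := exists_ne t.i
    exact ⟨t.i, ⟨w, hw⟩, 0, fun ψ => by simp [← hij]⟩
  · refine ⟨t.i, ⟨t.j, Ne.symm hij⟩, t.a⁻¹ * t.b, fun ψ => ?_⟩
    simp [Ne.symm hij, ← mul_assoc, ha]

theorem pow_card_le_ncard_solutions_mul [GroupWithZero G] [Finite G] [Finite α]
    (E : List (MonomialEquation α G)) :
    Nat.card G ^ Nat.card α ≤ (solutions E).ncard * Nat.card G ^ E.length := by
  have hG : 0 < Nat.card G := Nat.card_pos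
  induction hn : E.length generalizing α E with
  | zero =>
    obtain rfl := List.eq_nil_of_length_eq_zero hn
    have huniv : solutions ([] : List (MonomialEquation α G)) = Set.univ := by simp [solutions]
    rw [huniv, Set.ncard_univ, Nat.card_fun, pow_zero, mul_one]
  | succ n ih =>
    obtain ⟨t, E, rfl⟩ := List.exists_cons_of_length_eq_add_one hn
    rcases subsingleton_or_nontrivial α with hα | hα
    · have hzero : 0 ∈ solutions (t :: E) := fun t _ => by simp
      have hpos := (Set.ncard_pos (Set.toFinite _)).2 ⟨_, hzero⟩
      have hcard : Nat.card α ≤ n + 1 := (Finite.card_le_one_iff_subsingleton.2 hα).trans (by omega)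
      exact (Nat.pow_le_pow_right hG hcard).trans (Nat.le_mul_of_pos_left _ hpos)
    · obtain ⟨v, f, c, hinj, hsol⟩ := exists_elimination t
      have hle : (solutions (E.map (subst f c))).ncard ≤ (solutions (t :: E)).ncard := by
        refine Set.ncard_le_ncard_of_injOn _ (fun ψ hψ => ?_) hinj.injOn (Set.toFinite _)
        exact (solutions_append [t] E).ge ⟨hsol ψ, mem_solutions_map_subst.1 hψ⟩
      have hcard : Nat.card α = Nat.card {w // w ≠ v} + 1 := by
        rw [← Set.ncard_univ, ← Set.ncard_sdiff_singleton_add_one (Set.mem_univ v),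
          ← Set.compl_eq_univ_sdiff]
        rfl
      rw [hcard, pow_succ, pow_succ, ← mul_assoc]
      exact Nat.mul_le_mul_right _
        ((ih _ (by simpa using hn)).trans (Nat.mul_le_mul_right _ hle))

end MonomialEquation

/-- The fixed points of `x = (g, σ)` in its action `(x φ)(j) = g_j φ(σ⁻¹ j)` on the functions with
values in `Γ ∪ {0}`. -/
def potentials (x : Wreath Γ α) : Set (α → WithZero Γ) :=
  {φ | ∀ j, φ j = x.left j * φ (x.right⁻¹ j)}

theorem potentials_inter_subset (x y : Wreath Γ α) :
    potentials x ∩ potentials y ⊆ potentials (x * y) := by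
  rintro φ ⟨hx, hy⟩ j
  rw [hx, hy, mul_left_apply, WithZero.coe_mul, mul_assoc, SemidirectProduct.mul_right,
    mul_inv_rev, Equiv.Perm.mul_apply]

theorem single_mem_potentials_iff [DecidableEq α] {x : Wreath Γ α} {j : α} :
    Pi.single j 1 ∈ potentials x ↔ j ∉ supp x := by
  rw [notMem_supp]
  constructor
  · intro h
    have hj := h j
    have hfix : x.right⁻¹ j = j := by
      by_contra hne
      rw [Pi.single_eq_of_ne hne, Pi.single_eq_same, mul_zero] at hj
      exact one_ne_zero hj
    rw [hfix, Pi.single_eq_same, mul_one] at hj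
    exact ⟨(Equiv.Perm.inv_eq_iff_eq.1 hfix).symm, WithZero.coe_inj.1 hj.symm⟩
  · rintro ⟨hr, hl⟩ i
    rcases eq_or_ne i j with rfl | hne
    · rw [Equiv.Perm.inv_eq_iff_eq.2 hr.symm, hl]
      simp
    · have hne' : x.right⁻¹ i ≠ j := fun h => hne (by rw [Equiv.Perm.inv_eq_iff_eq.1 h, hr])
      rw [Pi.single_eq_of_ne hne, Pi.single_eq_of_ne hne', mul_zero]

/-- The pointwise condition is only asked along the first `s` steps, so that the equation at a
chosen point of a cycle can be left out. -/
theorem apply_right_pow_eq {x : Wreath Γ α} {φ : α → WithZero Γ} {i : α} {s : ℕ}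
    (h : ∀ t < s, φ ((x.right ^ (t + 1)) i) =
      x.left ((x.right ^ (t + 1)) i) * φ (x.right⁻¹ ((x.right ^ (t + 1)) i))) :
    φ ((x.right ^ s) i) = partialProduct x s (x.right i) * φ i := by
  induction s with
  | zero => simp
  | succ s ih =>
    have hback : x.right⁻¹ ((x.right ^ (s + 1)) i) = (x.right ^ s) i := by
      rw [Equiv.Perm.inv_eq_iff_eq, pow_succ', Equiv.Perm.mul_apply]
    rw [h s s.lt_succ_self, hback, ih fun t ht => h t (ht.trans s.lt_succ_self),
      partialProduct_succ, pow_succ, Equiv.Perm.mul_apply, WithZero.coe_mul, mul_assoc]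

theorem apply_right_pow_eq_of_mem_potentials {x : Wreath Γ α} {φ : α → WithZero Γ}
    (hφ : φ ∈ potentials x) (s : ℕ) (i : α) :
    φ ((x.right ^ s) i) = partialProduct x s (x.right i) * φ i :=
  apply_right_pow_eq fun _ _ => hφ _

theorem eq_zero_of_mem_potentials {x : Wreath Γ α} {φ : α → WithZero Γ} (hφ : φ ∈ potentials x)
    {i : α} (hi : cycleProduct x i ≠ 1) : φ i = 0 := by
  obtain ⟨j, rfl⟩ := x.right.surjective i
  have hperiod : (x.right ^ Function.minimalPeriod x.right (x.right j)) j = j := by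
    apply x.right.injective
    rw [← Equiv.Perm.mul_apply, ← pow_succ', pow_succ, Equiv.Perm.mul_apply,
      pow_minimalPeriod_apply]
  have hj : φ j = 0 := by
    have h := apply_right_pow_eq_of_mem_potentials hφ
      (Function.minimalPeriod x.right (x.right j)) j
    rw [hperiod, ← cycleProduct_eq_partialProduct] at h
    by_contra hne
    exact hi (WithZero.coe_inj.1 ((mul_eq_right₀ hne).1 h.symm))
  rw [hφ, Equiv.Perm.inv_def, Equiv.symm_apply_apply, hj, mul_zero]

/-- `R` consists of one point of each cycle of `x` with trivial cycle-product. -/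
structure IsTransversal (x : Wreath Γ α) (R : Finset α) : Prop where
  cycleProduct_eq_one {i : α} (hi : i ∈ R) : cycleProduct x i = 1
  eq_of_sameCycle {i j : α} (hi : i ∈ R) (hj : j ∈ R) (h : x.right.SameCycle i j) : i = j
  exists_sameCycle {i : α} (hi : cycleProduct x i = 1) : ∃ j ∈ R, x.right.SameCycle j i

theorem HasModType.exists_isTransversal [Finite α] {x : Wreath Γ α} {ν : ModType Γ}
    (h : HasModType x ν) : ∃ R, IsTransversal x R ∧ degree ν + R.card = Nat.card α := by
  classical
  obtain ⟨ι, k, p, e, s, _, H⟩ := exists_intertwines_model x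
  have := finite_of_sigma_equiv e
  have := Fintype.ofFinite ι
  have hcycle (i : ι) (a : α) : x.right.SameCycle (e ⟨i, 0⟩) a ↔ (e.symm a).1 = i := by
    obtain ⟨⟨i', t⟩, rfl⟩ := e.surjective a
    have := Set.ext_iff.1 (H.image_cycle ⟨i, 0⟩) (e ⟨i', t⟩)
    rw [model_setOf_sameCycle] at this
    simpa [eq_comm] using this.symm
  have hprod (a : α) : cycleProduct x a = 1 ↔ p (e.symm a).1 = 1 := by
    obtain ⟨j, rfl⟩ := e.surjective a
    rw [← mk_eq_one_iff, ← mk_eq_one_iff, e.symm_apply_apply, ← model_mk_cycleProduct k p j,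
      ← H.mk_cycleProduct j]
    rfl
  have hinj : Function.Injective fun i => e ⟨i, 0⟩ :=
    fun _ _ hi => congrArg Sigma.fst (e.injective hi)
  refine ⟨(Finset.univ.filter fun i => p i = 1).image fun i => e ⟨i, 0⟩, ⟨?_, ?_, ?_⟩, ?_⟩
  · intro _ hmem
    obtain ⟨i, hi, rfl⟩ := Finset.mem_image.1 hmem
    simpa [hprod] using hi
  · intro _ _ hi hj hij
    obtain ⟨i, -, rfl⟩ := Finset.mem_image.1 hi
    obtain ⟨j, -, rfl⟩ := Finset.mem_image.1 hj
    rw [hcycle, e.symm_apply_apply] at hij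
    exact congrArg (fun i => e ⟨i, 0⟩) hij.symm
  · intro a ha
    exact ⟨_, Finset.mem_image_of_mem _ (by simpa using (hprod a).1 ha), (hcycle _ a).2 rfl⟩
  · rw [Finset.card_image_of_injective _ hinj, ← Nat.card_congr e, Nat.card_sigma]
    simpa using ((H.hasModType_iff ν).1 h).degree_add_card_model_trivial

namespace IsTransversal

variable [Finite α] {x : Wreath Γ α} {R : Finset α}

/-- The equations at the other points of the cycle of `i ∈ R` determine `φ` on this cycle; since
the cycle-product is trivial, they imply the equation at `i`. -/
theorem apply_eq_of_forall_notMem (hR : IsTransversal x R) {φ : α → WithZero Γ}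
    (hφ : ∀ j ∉ R, φ j = x.left j * φ (x.right⁻¹ j)) {i : α} (hi : i ∈ R) :
    φ i = x.left i * φ (x.right⁻¹ i) := by
  have hcycle : x.right.SameCycle i (x.right i) := ⟨1, rfl⟩
  have hone : cycleProduct x (x.right i) = 1 := by
    rw [← mk_eq_one_iff, mk_cycleProduct_eq_of_sameCycle hcycle, mk_eq_one_iff,
      hR.cycleProduct_eq_one hi]
  have hperiod : Function.minimalPeriod x.right (x.right i) = Function.minimalPeriod x.right i := by
    have := (intertwines_conj x x).minimalPeriod_eq i
    rwa [mul_inv_cancel_right] at this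
  obtain ⟨m, hm⟩ := Nat.exists_eq_succ_of_ne_zero
    (Function.minimalPeriod_pos_of_mem_periodicPts (x.right.injective.mem_periodicPts i)).ne'
  have hlast : (x.right ^ (m + 1)) i = i := by
    rw [← Nat.succ_eq_add_one, ← hm, pow_minimalPeriod_apply]
  have hoff (t : ℕ) (ht : t < m) : (x.right ^ (t + 1)) i ∉ R := by
    intro hmem
    have hfix := (hR.eq_of_sameCycle hi hmem ⟨(t + 1 : ℕ), by rw [zpow_natCast]⟩).symm
    rw [Equiv.Perm.coe_pow] at hfix
    have := Function.IsPeriodicPt.minimalPeriod_le t.succ_pos hfix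
    omega
  have hstep := apply_right_pow_eq fun t ht => hφ _ (hoff t ht)
  rw [cycleProduct_eq_partialProduct, hperiod, hm, partialProduct_succ, ← Equiv.Perm.mul_apply,
    ← pow_succ, hlast] at hone
  rw [Equiv.Perm.inv_eq_iff_eq.2 (show i = x.right ((x.right ^ m) i) by
    rw [← Equiv.Perm.mul_apply, ← pow_succ', hlast]), hstep, ← mul_assoc, ← WithZero.coe_mul, hone,
    WithZero.coe_one, one_mul]

theorem exists_potentials_eq_solutions (hR : IsTransversal x R) :
    ∃ E : List (MonomialEquation α (WithZero Γ)),
      potentials x = MonomialEquation.solutions E ∧ E.length + R.card = Nat.card α := by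
  classical
  have := Fintype.ofFinite α
  refine ⟨Rᶜ.toList.map fun j => ⟨j, x.right⁻¹ j, 1, x.left j⟩, ?_, ?_⟩
  · ext φ
    simp only [MonomialEquation.solutions, List.forall_mem_map, Finset.mem_toList,
      Finset.mem_compl, one_mul, Set.mem_ofPred_eq]
    refine ⟨fun hφ j _ => hφ j, fun hφ j => ?_⟩
    by_cases hj : j ∈ R
    · exact hR.apply_eq_of_forall_notMem hφ hj
    · exact hφ j hj
  · rw [List.length_map, Finset.length_toList, Finset.card_compl_add_card,
      Nat.card_eq_fintype_card]

theorem ncard_potentials_le [Finite Γ] (hR : IsTransversal x R) :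
    (potentials x).ncard ≤ Nat.card (WithZero Γ) ^ R.card := by
  have : Finite (WithZero Γ) := inferInstanceAs (Finite (Option Γ))
  rw [← Nat.card_eq_finsetCard, ← Nat.card_fun, ← Set.ncard_univ]
  refine Set.ncard_le_ncard_of_injOn (fun φ (i : R) => φ i) (fun _ _ => Set.mem_univ _) ?_
    (Set.toFinite _)
  intro φ hφ ψ hψ heq
  funext i
  by_cases hi : cycleProduct x i = 1
  · obtain ⟨j, hj, hji⟩ := hR.exists_sameCycle hi
    obtain ⟨n, rfl⟩ := hji.exists_nat_pow_eq
    rw [apply_right_pow_eq_of_mem_potentials hφ, apply_right_pow_eq_of_mem_potentials hψ,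
      show φ j = ψ j from congrFun heq ⟨j, hj⟩]
  · rw [eq_zero_of_mem_potentials hφ hi, eq_zero_of_mem_potentials hψ hi]

end IsTransversal

theorem potentials_mul_of_degree_eq_add [Finite Γ] [Finite α] {x y : Wreath Γ α}
    {lam mu ν : ModType Γ} (hx : HasModType x lam) (hy : HasModType y mu)
    (hxy : HasModType (x * y) ν) (hdeg : degree ν = degree lam + degree mu) :
    potentials (x * y) = potentials x ∩ potentials y := by
  have : Finite (WithZero Γ) := inferInstanceAs (Finite (Option Γ))
  obtain ⟨R, hR, hRcard⟩ := hx.exists_isTransversal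
  obtain ⟨S, hS, hScard⟩ := hy.exists_isTransversal
  obtain ⟨T, hT, hTcard⟩ := hxy.exists_isTransversal
  obtain ⟨E, hE, hElength⟩ := hR.exists_potentials_eq_solutions
  obtain ⟨F, hF, hFlength⟩ := hS.exists_potentials_eq_solutions
  refine (Set.eq_of_subset_of_ncard_le (potentials_inter_subset x y) ?_ (Set.toFinite _)).symm
  have hlower := MonomialEquation.pow_card_le_ncard_solutions_mul (E ++ F)
  have hsplit : Nat.card α = T.card + (E ++ F).length := by
    rw [List.length_append]; omega
  rw [MonomialEquation.solutions_append, ← hE, ← hF, hsplit, pow_add] at hlower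
  exact hT.ncard_potentials_le.trans
    (Nat.le_of_mul_le_mul_right hlower (Nat.pow_pos Nat.card_pos))

theorem supp_union_subset_supp_mul [Finite Γ] [Finite α] {x y : Wreath Γ α}
    {lam mu ν : ModType Γ} (hx : HasModType x lam) (hy : HasModType y mu)
    (hxy : HasModType (x * y) ν) (hdeg : degree ν = degree lam + degree mu) :
    supp x ∪ supp y ⊆ supp (x * y) := by
  classical
  intro j
  contrapose
  rw [Set.mem_union, not_or, ← single_mem_potentials_iff, ← single_mem_potentials_iff,
    ← single_mem_potentials_iff, potentials_mul_of_degree_eq_add hx hy hxy hdeg]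
  exact id

instance finite_wreath [Finite Γ] [Finite α] : Finite (Wreath Γ α) :=
  Finite.of_equiv _ SemidirectProduct.equivProd.symm

/-- The factorizations `z = x y` with `x` of modified type `lam` and `y` of modified type `mu`. -/
def factorizations (lam mu : ModType Γ) (z : Wreath Γ α) : Set (Wreath Γ α × Wreath Γ α) :=
  {q | HasModType q.1 lam ∧ HasModType q.2 mu ∧ q.1 * q.2 = z}

/-- The factorizations `z = x y`, with `x` and `y` of given modified types, in which the points
moved by `x` or by `y` are exactly those of `S`. -/
def factorizationsOn (lam mu : ModType Γ) (z : Wreath Γ α) (S : Set α) :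
    Set (Wreath Γ α × Wreath Γ α) :=
  {q ∈ factorizations lam mu z | supp q.1 ∪ supp q.2 = S}

theorem ncard_factorizationsOn_map (lam mu : ModType Γ) {F : Wreath Γ α →* Wreath Γ β}
    {e : α ↪ β} (hF : ∀ x, ∃ h, Intertwines e h x (F x)) (hinj : Function.Injective F)
    (hsurj : ∀ y, supp y ⊆ Set.range e → ∃ x, F x = y) (z : Wreath Γ α) (S : Set α) :
    (factorizationsOn lam mu (F z) (e '' S)).ncard = (factorizationsOn lam mu z S).ncard := by
  have hmem (x y : Wreath Γ α) : (F x, F y) ∈ factorizationsOn lam mu (F z) (e '' S) ↔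
      (x, y) ∈ factorizationsOn lam mu z S := by
    obtain ⟨h, Hx⟩ := hF x
    obtain ⟨h', Hy⟩ := hF y
    simp only [factorizationsOn, factorizations, Set.mem_ofPred_eq, Hx.hasModType_iff,
      Hy.hasModType_iff, ← map_mul, hinj.eq_iff, ← Hx.image_supp, ← Hy.image_supp,
      ← Set.image_union, (Set.image_injective.2 e.injective).eq_iff]
  rw [← Set.ncard_image_of_injective (factorizationsOn lam mu z S) (hinj.prodMap hinj)]
  congr 1
  ext ⟨x, y⟩
  constructor
  · intro hxy
    have hS : supp x ∪ supp y ⊆ Set.range e := hxy.2 ▸ Set.image_subset_range e S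
    obtain ⟨x, rfl⟩ := hsurj x (Set.subset_union_left.trans hS)
    obtain ⟨y, rfl⟩ := hsurj y (Set.subset_union_right.trans hS)
    exact ⟨(x, y), (hmem x y).1 hxy, rfl⟩
  · rintro ⟨⟨x, y⟩, hxy, h⟩
    exact h ▸ (hmem x y).2 hxy

theorem ncard_factorizationsOn_univ_eq_of_isConj (lam mu : ModType Γ) {z z' : Wreath Γ α}
    (h : IsConj z z') :
    (factorizationsOn lam mu z Set.univ).ncard = (factorizationsOn lam mu z' Set.univ).ncard := by
  obtain ⟨w, rfl⟩ := isConj_iff.1 h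
  rw [← ncard_factorizationsOn_map lam mu (F := (MulAut.conj w).toMonoidHom)
    (e := w.right.toEmbedding) (fun x => ⟨_, intertwines_conj w x⟩) (MulAut.conj w).injective
    (fun y _ => (MulAut.conj w).surjective y) z Set.univ]
  simp

open Classical in
/-- The number of factorizations of an element `z ∈ Γ_k` of modified type `ν` into elements of
modified types `lam` and `mu` that together move all `k` points. It does not depend on `z`, and is
`0` if there is no such `z`. -/
def factorizationNumber (lam mu ν : ModType Γ) (k : ℕ) : ℕ :=
  if h : ∃ z : WreathFin Γ k, HasModType z ν then (factorizationsOn lam mu h.choose Set.univ).ncard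
  else 0

theorem factorizationNumber_eq_ncard (lam mu : ModType Γ) {ν : ModType Γ} {k : ℕ}
    {z : WreathFin Γ k} (hz : HasModType z ν) :
    factorizationNumber lam mu ν k = (factorizationsOn lam mu z Set.univ).ncard := by
  have h : ∃ z : WreathFin Γ k, HasModType z ν := ⟨z, hz⟩
  rw [factorizationNumber, dif_pos h]
  exact ncard_factorizationsOn_univ_eq_of_isConj lam mu (h.choose_spec.isConj hz)

theorem ncard_factorizationsOn (lam mu : ModType Γ) {ν : ModType Γ} {z : Wreath Γ α}
    (hz : HasModType z ν) {k : ℕ} (e : Fin k ↪ α) (h : supp z ⊆ Set.range e) :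
    (factorizationsOn lam mu z (Set.range e)).ncard = factorizationNumber lam mu ν k := by
  obtain ⟨z, rfl⟩ := exists_embedHom_eq e h
  rw [(intertwines_embedHom e z).hasModType_iff] at hz
  rw [← Set.image_univ, factorizationNumber_eq_ncard lam mu hz]
  exact ncard_factorizationsOn_map lam mu (fun x => ⟨1, intertwines_embedHom e x⟩)
    (embedHom_injective e) (fun y hy => exists_embedHom_eq e hy) z Set.univ

theorem HasModType.supportSize_le {n : ℕ} {x : WreathFin Γ n} {ν : ModType Γ}
    (h : HasModType x ν) : supportSize ν ≤ n := by
  rw [← h.ncard_supp (Set.toFinite _)]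
  exact (Set.ncard_le_card _).trans_eq (Nat.card_fin n)

theorem sum_Icc_apply_card {M : Type*} [AddCommMonoid M] [DecidableEq α] {s t : Finset α}
    (hst : s ⊆ t) (f : ℕ → M) : ∑ u ∈ Finset.Icc s t, f u.card =
      ∑ d ∈ Finset.range (t.card - s.card + 1), (t.card - s.card).choose d • f (s.card + d) := by
  have hdisj (u : Finset α) (hu : u ∈ (t \ s).powerset) : Disjoint s u :=
    Finset.disjoint_sdiff.mono_right (Finset.mem_powerset.1 hu)
  rw [Finset.Icc_eq_image_powerset hst, Finset.sum_image, ← Finset.card_sdiff_of_subset hst,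
    ← Finset.sum_powerset_apply_card fun d => f (s.card + d)]
  · exact Finset.sum_congr rfl fun u hu => by rw [Finset.card_union_of_disjoint (hdisj u hu)]
  · intro u hu v hv huv
    rw [← Finset.union_sdiff_cancel_left (hdisj u hu),
      ← Finset.union_sdiff_cancel_left (hdisj v hv)]
    exact congrArg (· \ s) huv

section FactorizationNumber

variable [Finite Γ] {lam mu ν : ModType Γ} {k n : ℕ}

theorem factorizationNumber_ne_zero_iff :
    factorizationNumber lam mu ν k ≠ 0 ↔ ∃ x y : WreathFin Γ k, HasModType x lam ∧
      HasModType y mu ∧ HasModType (x * y) ν ∧ supp x ∪ supp y = Set.univ := by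
  constructor
  · intro h
    by_cases hz : ∃ z : WreathFin Γ k, HasModType z ν
    · obtain ⟨z, hz⟩ := hz
      rw [factorizationNumber_eq_ncard lam mu hz] at h
      obtain ⟨⟨x, y⟩, ⟨hx, hy, rfl⟩, hS⟩ := Set.nonempty_of_ncard_ne_zero h
      exact ⟨x, y, hx, hy, hz, hS⟩
    · exact absurd (dif_neg hz) h
  · rintro ⟨x, y, hx, hy, hxy, hS⟩
    rw [factorizationNumber_eq_ncard lam mu hxy]
    exact Set.ncard_ne_zero_of_mem (a := (x, y)) ⟨⟨hx, hy, rfl⟩, hS⟩ (Set.toFinite _)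

theorem le_of_factorizationNumber_ne_zero (h : factorizationNumber lam mu ν k ≠ 0) :
    supportSize ν ≤ k ∧ k ≤ supportSize lam + supportSize mu := by
  obtain ⟨x, y, hx, hy, hxy, hS⟩ := factorizationNumber_ne_zero_iff.1 h
  refine ⟨hxy.supportSize_le, ?_⟩
  have hle := Set.ncard_union_le (supp x) (supp y)
  rwa [hS, Set.ncard_univ, Nat.card_fin, hx.ncard_supp (Set.toFinite _),
    hy.ncard_supp (Set.toFinite _)] at hle

theorem eq_supportSize_of_factorizationNumber_ne_zero (hdeg : degree ν = degree lam + degree mu)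
    (h : factorizationNumber lam mu ν k ≠ 0) : k = supportSize ν := by
  obtain ⟨x, y, hx, hy, hxy, hS⟩ := factorizationNumber_ne_zero_iff.1 h
  have huniv := supp_union_subset_supp_mul hx hy hxy hdeg
  rw [hS, Set.univ_subset_iff] at huniv
  rw [← hxy.ncard_supp (Set.toFinite _), huniv, Set.ncard_univ, Nat.card_fin]

theorem ncard_factorizations_eq_sum [Fintype α] [DecidableEq α] (lam mu : ModType Γ)
    (z : Wreath Γ α) [Fintype (supp z)] :
    (factorizations lam mu z).ncard =
      ∑ S ∈ Finset.Icc (supp z).toFinset Finset.univ, (factorizationsOn lam mu z S).ncard := by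
  classical
  have := Fintype.ofFinite (Wreath Γ α × Wreath Γ α)
  rw [Set.ncard_eq_toFinset_card',
    Finset.card_eq_sum_card_fiberwise (f := fun q => (supp q.1 ∪ supp q.2).toFinset)
      (t := Finset.Icc (supp z).toFinset Finset.univ) fun q hq => ?_]
  · refine Finset.sum_congr rfl fun S _ => ?_
    rw [Set.ncard_eq_toFinset_card']
    congr 1
    ext q
    rw [Finset.mem_filter, Set.mem_toFinset, Set.mem_toFinset]
    simp only [factorizationsOn, Set.mem_ofPred_eq, ← Finset.coe_inj, Set.coe_toFinset]
  · obtain ⟨-, -, rfl⟩ := Set.mem_toFinset.1 hq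
    exact Finset.mem_coe.2 (Finset.mem_Icc.2
      ⟨Set.toFinset_mono (supp_mul_subset _ _), Finset.subset_univ _⟩)

theorem ncard_factorizations (lam mu : ModType Γ) {z : WreathFin Γ n} (hz : HasModType z ν) :
    (factorizations lam mu z).ncard = ∑ d ∈ Finset.range (supportSize lam + supportSize mu + 1),
      (n - supportSize ν).choose d * factorizationNumber lam mu ν (supportSize ν + d) := by
  classical
  have hcard : (supp z).toFinset.card = supportSize ν := by
    rw [← Set.ncard_eq_toFinset_card', hz.ncard_supp (Set.toFinite _)]
  have hterm (S : Finset (Fin n)) (hS : S ∈ Finset.Icc (supp z).toFinset Finset.univ) :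
      (factorizationsOn lam mu z S).ncard = factorizationNumber lam mu ν S.card := by
    have hrange : Set.range (S.orderEmbOfFin rfl).toEmbedding = (S : Set (Fin n)) :=
      Finset.range_orderEmbOfFin S rfl
    have hsub := Set.toFinset_subset.1 (Finset.mem_Icc.1 hS).1
    rw [← hrange] at hsub ⊢
    exact ncard_factorizationsOn lam mu hz _ hsub
  rw [ncard_factorizations_eq_sum, Finset.sum_congr rfl hterm,
    sum_Icc_apply_card (Finset.subset_univ _) (factorizationNumber lam mu ν), hcard,
    Finset.card_univ, Fintype.card_fin]
  refine (finsum_eq_sum_of_support_subset _ fun d hd => ?_).symm.trans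
    (finsum_eq_sum_of_support_subset _ fun d hd => ?_) <;>
    rw [Function.mem_support, smul_eq_mul, mul_ne_zero_iff] at hd <;>
    rw [Finset.mem_coe, Finset.mem_range, Nat.lt_succ_iff]
  · exact not_lt.1 fun h => hd.1 (Nat.choose_eq_zero_of_lt h)
  · have := (le_of_factorizationNumber_ne_zero hd.2).2
    omega

end FactorizationNumber

theorem degree_choose {K : Type*} [Field K] [CharZero K] {p : K[X]} (hp : p.natDegree ≠ 0)
    (d : ℕ) : (Ring.choose p d).degree = ↑(d * p.natDegree) := by
  have hcomp : (d.factorial : K) • Ring.choose p d = (descPochhammer K d).comp p := by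
    rw [Nat.cast_smul_eq_nsmul, ← Ring.descPochhammer_eq_factorial_smul_choose,
      ← descPochhammer_map (Int.castRingHom K), comp, eval₂_map, ← aeval_eq_smeval, aeval_def]
    congr 1
  have hne : (descPochhammer K d).comp p ≠ 0 := fun h =>
    ((monic_descPochhammer K d).ne_zero <| (comp_eq_zero_iff.1 h).resolve_right
      fun h' => hp (h'.2 ▸ natDegree_C _))
  have hd : (d.factorial : K) ≠ 0 := Nat.cast_ne_zero.2 d.factorial_ne_zero
  rw [← degree_C_mul hd, ← smul_eq_C_mul, hcomp, degree_eq_natDegree hne, natDegree_comp,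
    descPochhammer_natDegree]

theorem degree_sum_smul {K : Type*} [Field K] {P : ℕ → K[X]} (hP : ∀ d, (P d).degree = d)
    {s : Finset ℕ} {c : ℕ → K} {d : ℕ} (hd : IsGreatest {d | d ∈ s ∧ c d ≠ 0} d) :
    (∑ i ∈ s, c i • P i).degree = d := by
  have hdeg {i : ℕ} (hi : c i ≠ 0) : (c i • P i).degree = i := by
    rw [smul_eq_C_mul, degree_C_mul hi, hP]
  rw [degree_sum_eq_of_disjoint]
  · refine le_antisymm (Finset.sup_le fun i hi => ?_) ?_
    · by_cases hci : c i = 0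
      · simp [hci]
      · rw [hdeg hci]
        exact_mod_cast hd.2 ⟨hi, hci⟩
    · rw [← hdeg hd.1.2]
      exact Finset.le_sup (f := fun i => (c i • P i).degree) hd.1.1
  · rintro i ⟨-, hi⟩ j ⟨-, hj⟩ hij h
    simp only [Function.comp_apply, hdeg (left_ne_zero_of_smul hi),
      hdeg (left_ne_zero_of_smul hj)] at h
    exact hij (by exact_mod_cast h)

/-- The polynomial `f_{λμ}^ν`: the sum of the products `N_d * choose (t - m) d`, where `m` is the
number of points moved by an element of modified type `ν`, and `N_d` the number of factorizations of
such an element that move exactly `d` given further points. -/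
def structurePoly (lam mu ν : ModType Γ) : ℚ[X] :=
  ∑ d ∈ Finset.range (supportSize lam + supportSize mu + 1),
    (factorizationNumber lam mu ν (supportSize ν + d) : ℚ) •
      Ring.choose (X - C (supportSize ν : ℚ)) d

/-- The integer `f_{λμ}^ν(n)`, computed in `ℤ`. -/
def structureValue (lam mu ν : ModType Γ) (n : ℕ) : ℤ :=
  ∑ d ∈ Finset.range (supportSize lam + supportSize mu + 1),
    factorizationNumber lam mu ν (supportSize ν + d) * Ring.choose ((n : ℤ) - supportSize ν) d

theorem eval_structurePoly (lam mu ν : ModType Γ) (n : ℕ) :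
    (structurePoly lam mu ν).eval (n : ℚ) = structureValue lam mu ν n := by
  have hchoose (d : ℕ) : (Ring.choose (X - C (supportSize ν : ℚ)) d).eval (n : ℚ) =
      ((Ring.choose ((n : ℤ) - supportSize ν) d : ℤ) : ℚ) := by
    rw [← coe_evalRingHom, ← eq_intCast (Int.castRingHom ℚ), Ring.map_choose, Ring.map_choose]
    simp
  simp only [structurePoly, structureValue, eval_finsetSum, eval_smul, hchoose, smul_eq_mul,
    Int.cast_sum, Int.cast_mul, Int.cast_natCast]

section StructurePoly

variable [Finite Γ] {lam mu ν : ModType Γ}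

theorem structureValue_eq_ncard (lam mu : ModType Γ) {n : ℕ} {z : WreathFin Γ n}
    (hz : HasModType z ν) : structureValue lam mu ν n = (factorizations lam mu z).ncard := by
  rw [ncard_factorizations lam mu hz, structureValue, Nat.cast_sum]
  refine Finset.sum_congr rfl fun d _ => ?_
  rw [← Nat.cast_sub hz.supportSize_le, Ring.choose_natCast, Nat.cast_mul, mul_comm]

theorem degree_structurePoly {d : ℕ}
    (hd : IsGreatest {d | factorizationNumber lam mu ν (supportSize ν + d) ≠ 0} d) :
    (structurePoly lam mu ν).degree = d := by
  refine degree_sum_smul (fun i => ?_) ⟨⟨?_, Nat.cast_ne_zero.2 hd.1⟩, ?_⟩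
  · rw [degree_choose (by rw [natDegree_X_sub_C]; exact one_ne_zero), natDegree_X_sub_C, mul_one]
  · have := (le_of_factorizationNumber_ne_zero hd.1).2
    exact Finset.mem_range.2 (by omega)
  · exact fun i hi => hd.2 (Nat.cast_ne_zero.1 hi.2)

theorem exists_isGreatest_factorizationNumber {k : ℕ} (hk : factorizationNumber lam mu ν k ≠ 0) :
    ∃ d, IsGreatest {d | factorizationNumber lam mu ν (supportSize ν + d) ≠ 0} d := by
  have hbdd : BddAbove {d | factorizationNumber lam mu ν (supportSize ν + d) ≠ 0} :=
    ⟨supportSize lam + supportSize mu, fun d hd =>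
      (Nat.le_add_left _ _).trans (le_of_factorizationNumber_ne_zero hd).2⟩
  obtain ⟨d, rfl⟩ := Nat.exists_eq_add_of_le (le_of_factorizationNumber_ne_zero hk).1
  exact ⟨_, Nat.sSup_mem ⟨d, hk⟩ hbdd, fun i hi => le_csSup hbdd hi⟩

theorem structurePoly_eq_zero_iff :
    structurePoly lam mu ν = 0 ↔ ∀ k, factorizationNumber lam mu ν k = 0 := by
  refine ⟨fun h k => ?_, fun h => by simp [structurePoly, h]⟩
  by_contra hk
  obtain ⟨d, hd⟩ := exists_isGreatest_factorizationNumber hk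
  simpa [h] using degree_structurePoly hd

theorem isGreatest_natDegree_structurePoly (h : structurePoly lam mu ν ≠ 0) :
    IsGreatest {d | factorizationNumber lam mu ν (supportSize ν + d) ≠ 0}
      (structurePoly lam mu ν).natDegree := by
  obtain ⟨k, hk⟩ := not_forall.1 (structurePoly_eq_zero_iff.not.1 h)
  obtain ⟨d, hd⟩ := exists_isGreatest_factorizationNumber hk
  rwa [natDegree_eq_of_degree_eq_some (degree_structurePoly hd)]

theorem structurePoly_eq_C (hdeg : degree ν = degree lam + degree mu) :
    structurePoly lam mu ν = C (factorizationNumber lam mu ν (supportSize ν) : ℚ) := by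
  rw [structurePoly, Finset.sum_eq_single 0, add_zero, Ring.choose_zero_right, smul_eq_C_mul,
    mul_one]
  · intro d _ hd
    have h : factorizationNumber lam mu ν (supportSize ν + d) = 0 := by
      by_contra h
      exact hd (Nat.add_eq_left.1 (eq_supportSize_of_factorizationNumber_ne_zero hdeg h))
    rw [h, Nat.cast_zero, zero_smul]
  · simp

end StructurePoly

theorem toInf_mem_classInf_iff {n : ℕ} {x : WreathFin Γ n} {lam : ModType Γ} :
    toInf Γ n x ∈ classInf lam ↔ HasModType x lam := by
  change HasModType (extend Γ n x) lam ↔ _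
  rw [extend_eq_embedHom, (intertwines_embedHom _ x).hasModType_iff]

section ClassSum

variable [Finite Γ]

open Classical in
theorem coeff_classSum (n : ℕ) (lam : ModType Γ) (z : WreathFin Γ n) :
    (classSum n lam).coeff z = if HasModType z lam then 1 else 0 := by
  have := Fintype.ofFinite (WreathFin Γ n)
  simp only [classSum, toInf_mem_classInf_iff]
  rw [finsum_mem_eq_finite_toFinset_sum _ (Set.toFinite _), MonoidAlgebra.coeff_sum,
    Finsupp.finsetSum_apply]
  simp [Finsupp.single_apply]

theorem coeff_classSum_mul (n : ℕ) (lam mu : ModType Γ) (z : WreathFin Γ n) :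
    (classSum n lam * classSum n mu).coeff z = (factorizations lam mu z).ncard := by
  classical
  have := Fintype.ofFinite (WreathFin Γ n)
  rw [MonoidAlgebra.coeff_mul_antidiag _ _ z {q | q.1 * q.2 = z} (by simp),
    Set.ncard_eq_toFinset_card', Finset.card_eq_sum_ones, Nat.cast_sum]
  simp only [coeff_classSum, mul_ite, mul_one, mul_zero, Nat.cast_one, ← Finset.sum_filter,
    Finset.filter_filter]
  refine Finset.sum_congr (Finset.ext fun q => ?_) fun _ _ => rfl
  rw [Finset.mem_filter, Set.mem_toFinset]
  simp only [factorizations, Finset.mem_univ, Set.mem_ofPred_eq]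
  tauto

theorem coeff_sum_smul_classSum {n : ℕ} (a : ModType Γ →₀ ℤ) {z : WreathFin Γ n} {ν : ModType Γ}
    (hz : HasModType z ν) : (a.sum fun ν m => m • classSum n ν).coeff z = a ν := by
  classical
  have hiff (ν' : ModType Γ) : HasModType z ν' ↔ ν' = ν :=
    ⟨fun h => h.unique hz, fun h => h ▸ hz⟩
  simp only [Finsupp.sum, MonoidAlgebra.coeff_sum, Finsupp.finsetSum_apply,
    MonoidAlgebra.coeff_smul_apply, coeff_classSum, hiff]
  simp +contextual

theorem isStructureConstants_iff {n : ℕ} {lam mu : ModType Γ} {a : ModType Γ →₀ ℤ} :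
    IsStructureConstants n lam mu a ↔ ∀ (z : WreathFin Γ n) (ν : ModType Γ), HasModType z ν →
      (factorizations lam mu z).ncard = a ν := by
  refine ⟨fun h z ν hz => ?_, fun h => MonoidAlgebra.ext (Finsupp.ext fun z => ?_)⟩
  · rw [← coeff_classSum_mul, h, coeff_sum_smul_classSum a hz]
  · obtain ⟨ν, hz⟩ := exists_hasModType z
    rw [coeff_sum_smul_classSum a hz, coeff_classSum_mul, h z ν hz]

theorem eval_structurePoly_eq_of_isStructureConstants {n : ℕ} {lam mu ν : ModType Γ}
    (hn : supportSize ν ≤ n) {a : ModType Γ →₀ ℤ} (ha : IsStructureConstants n lam mu a) :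
    (structurePoly lam mu ν).eval (n : ℚ) = a ν := by
  obtain ⟨z, hz⟩ := exists_hasModType_fin ν hn
  rw [eval_structurePoly, structureValue_eq_ncard lam mu hz, isStructureConstants_iff.1 ha z ν hz]

theorem finite_support_structurePoly (lam mu : ModType Γ) :
    (Function.support (structurePoly lam mu)).Finite := by
  choose t ht using fun x : WreathFin Γ (supportSize lam + supportSize mu) => exists_hasModType x
  refine (Set.finite_range t).subset fun ν hν => ?_
  obtain ⟨k, hk⟩ := not_forall.1 (structurePoly_eq_zero_iff.not.1 hν)
  obtain ⟨hνk, hk⟩ := le_of_factorizationNumber_ne_zero hk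
  obtain ⟨x, hx⟩ := exists_hasModType_fin ν (hνk.trans hk)
  exact ⟨x, (ht x).unique hx⟩

theorem exists_isStructureConstants (lam mu : ModType Γ) (n : ℕ) :
    ∃ a, IsStructureConstants n lam mu a ∧
      ∀ ν, (structurePoly lam mu ν).eval (n : ℚ) = (a ν : ℚ) := by
  have hfin : (Function.support fun ν => structureValue lam mu ν n).Finite := by
    refine (finite_support_structurePoly lam mu).subset fun ν hν hzero => hν ?_
    rw [← Int.cast_eq_zero (α := ℚ), ← eval_structurePoly, hzero, eval_zero]
  exact ⟨Finsupp.ofSupportFinite _ hfin,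
    isStructureConstants_iff.2 fun z ν hz => (structureValue_eq_ncard lam mu hz).symm,
    fun ν => eval_structurePoly lam mu ν n⟩

theorem eq_structurePoly_of_eval_eq {lam mu ν : ModType Γ} {g : ℚ[X]}
    (hg : ∀ n : ℕ, supportSize ν ≤ n → ∀ a : ModType Γ →₀ ℤ,
      IsStructureConstants n lam mu a → g.eval (n : ℚ) = (a ν : ℚ)) :
    g = structurePoly lam mu ν := by
  refine eq_of_infinite_eval_eq _ _ (((Set.Ici_infinite (supportSize ν)).image
    (Nat.cast_injective (R := ℚ)).injOn).mono ?_)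
  rintro _ ⟨n, hn, rfl⟩
  obtain ⟨a, ha, hfa⟩ := exists_isStructureConstants lam mu n
  exact (hg n hn a ha).trans (hfa ν).symm

end ClassSum

theorem suppSet_singleton (x : wreathInf Γ) : suppSet {x} = supp (x : Wreath Γ ℕ) := by
  simp [suppSet]

theorem suppSet_pair (x y : wreathInf Γ) :
    suppSet {x, y} = supp (x : Wreath Γ ℕ) ∪ supp (y : Wreath Γ ℕ) := by
  ext j
  simp [suppSet]

theorem suppCard_mk_pair (x y : wreathInf Γ) :
    TupleClass.suppCard (Quotient.mk (tupleSetoid Γ 2) ![x, y]) = (suppSet {x, y}).ncard := by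
  change (suppSet (Set.range ![x, y])).ncard = _
  rw [Matrix.range_cons_cons_empty]

theorem ncard_suppSet_singleton {z : wreathInf Γ} {ν : ModType Γ} (hz : z ∈ classInf ν) :
    (suppSet {z}).ncard = supportSize ν := by
  rw [suppSet_singleton, HasModType.ncard_supp hz z.2]

theorem exists_embedHom_eq_pair (x y : wreathInf Γ) :
    ∃ (k : ℕ) (e : Fin k ↪ ℕ) (x' y' : WreathFin Γ k), embedHom Γ e x' = x ∧ embedHom Γ e y' = y ∧
      supp x' ∪ supp y' = Set.univ := by
  obtain ⟨k, e, he⟩ := (Set.Finite.union x.2 y.2).fin_embedding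
  obtain ⟨x', hx⟩ := exists_embedHom_eq e (Set.subset_union_left.trans he.ge)
  obtain ⟨y', hy⟩ := exists_embedHom_eq e (Set.subset_union_right.trans he.ge)
  refine ⟨k, e, x', y', hx, hy, Set.image_injective.2 e.injective ?_⟩
  rw [Set.image_union, (intertwines_embedHom e x').image_supp,
    (intertwines_embedHom e y').image_supp, hx, hy, Set.image_univ, he]

section PairClasses

variable [Finite Γ] {lam mu ν : ModType Γ}

theorem exists_mem_pairClasses_iff {k : ℕ} :
    (∃ C ∈ pairClasses lam mu ν, C.suppCard = k) ↔ factorizationNumber lam mu ν k ≠ 0 := by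
  rw [factorizationNumber_ne_zero_iff]
  constructor
  · rintro ⟨_, ⟨x, hx, y, hy, hxy, rfl⟩, hcard⟩
    obtain ⟨l, e, x', y', hx', hy', hS⟩ := exists_embedHom_eq_pair x y
    rw [suppCard_mk_pair, suppSet_pair, ← hx', ← hy', ← (intertwines_embedHom e x').image_supp,
      ← (intertwines_embedHom e y').image_supp, ← Set.image_union, hS,
      Set.ncard_image_of_injective _ e.injective, Set.ncard_univ, Nat.card_fin] at hcard
    subst hcard
    simp only [classInf, Set.mem_ofPred_eq, Subgroup.coe_mul, ← hx', ← hy', ← map_mul,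
      (intertwines_embedHom e _).hasModType_iff] at hx hy hxy
    exact ⟨x', y', hx, hy, hxy, hS⟩
  · rintro ⟨x, y, hx, hy, hxy, hS⟩
    refine ⟨_, ⟨toInf Γ k x, toInf_mem_classInf_iff.2 hx, toInf Γ k y,
      toInf_mem_classInf_iff.2 hy, ?_, rfl⟩, ?_⟩
    · rw [← map_mul]
      exact toInf_mem_classInf_iff.2 hxy
    · rw [suppCard_mk_pair, suppSet_pair]
      change (supp (extend Γ k x) ∪ supp (extend Γ k y)).ncard = k
      rw [extend_eq_embedHom, extend_eq_embedHom, ← (intertwines_embedHom _ x).image_supp,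
        ← (intertwines_embedHom _ y).image_supp, ← Set.image_union, hS,
        Set.ncard_image_of_injective _ Fin.valEmbedding.injective, Set.ncard_univ, Nat.card_fin]

theorem structurePoly_eq_zero_iff_pairClasses_eq_empty :
    structurePoly lam mu ν = 0 ↔ pairClasses lam mu ν = ∅ := by
  simp only [structurePoly_eq_zero_iff, ← not_ne_iff (b := 0), ← exists_mem_pairClasses_iff,
    ← not_exists, Set.eq_empty_iff_forall_notMem]
  exact not_congr ⟨fun ⟨_, C, hC, _⟩ => ⟨C, hC⟩, fun ⟨C, hC⟩ => ⟨_, C, hC, rfl⟩⟩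

theorem isGreatest_natDegree_structurePoly_pairClasses (h : (pairClasses lam mu ν).Nonempty)
    {z : wreathInf Γ} (hz : z ∈ classInf ν) :
    IsGreatest {d : ℤ | ∃ C ∈ pairClasses lam mu ν, d = C.suppCard - (suppSet {z}).ncard}
      (structurePoly lam mu ν).natDegree := by
  rw [ncard_suppSet_singleton hz]
  have hgreatest := isGreatest_natDegree_structurePoly
    (structurePoly_eq_zero_iff_pairClasses_eq_empty.not.2 h.ne_empty)
  constructor
  · obtain ⟨C, hC, hcard⟩ := exists_mem_pairClasses_iff.2 hgreatest.1
    exact ⟨C, hC, by rw [hcard, Nat.cast_add, add_sub_cancel_left]⟩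
  · rintro _ ⟨C, hC, rfl⟩
    have hne := exists_mem_pairClasses_iff.1 ⟨C, hC, rfl⟩
    obtain ⟨d, hd⟩ := Nat.exists_eq_add_of_le (le_of_factorizationNumber_ne_zero hne).1
    rw [hd] at hne ⊢
    rw [Nat.cast_add, add_sub_cancel_left]
    exact_mod_cast hgreatest.2 hne

theorem suppSet_pair_eq_suppSet_mul (hdeg : degree ν = degree lam + degree mu) {x y : wreathInf Γ}
    (hx : x ∈ classInf lam) (hy : y ∈ classInf mu) (hxy : x * y ∈ classInf ν) :
    suppSet {x, y} = suppSet {x * y} := by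
  rw [suppSet_pair, suppSet_singleton]
  refine Set.Subset.antisymm ?_ (supp_mul_subset _ _)
  obtain ⟨k, e, x', y', hx', hy', -⟩ := exists_embedHom_eq_pair x y
  simp only [classInf, Set.mem_ofPred_eq, Subgroup.coe_mul, ← hx', ← hy', ← map_mul,
    (intertwines_embedHom e _).hasModType_iff] at hx hy hxy
  rw [Subgroup.coe_mul, ← hx', ← hy', ← map_mul, ← (intertwines_embedHom e x').image_supp,
    ← (intertwines_embedHom e y').image_supp, ← (intertwines_embedHom e (x' * y')).image_supp,
    ← Set.image_union]
  exact Set.image_mono (supp_union_subset_supp_mul hx hy hxy hdeg)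

end PairClasses

end WreathFH

end

theorem mainTheorem1 {Γ : Type*} [Group Γ] [Finite Γ] (lam mu : WreathFH.ModType Γ) :
    ∃ f : WreathFH.ModType Γ →₀ ℚ[X],
      -- for every `n`, the values `f ν (n)` are integers and are structure constants
      (∀ n : ℕ, ∃ a : WreathFH.ModType Γ →₀ ℤ,
        WreathFH.IsStructureConstants n lam mu a ∧ ∀ ν, (f ν).eval (n : ℚ) = (a ν : ℚ)) ∧
      ∀ ν : WreathFH.ModType Γ,
        -- wherever the structure constant is determined, it is the value of `f ν`
        (∀ n : ℕ, WreathFH.degree ν + (ν 1).card ≤ n → ∀ a : WreathFH.ModType Γ →₀ ℤ,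
          WreathFH.IsStructureConstants n lam mu a → (f ν).eval (n : ℚ) = (a ν : ℚ)) ∧
        -- and `f ν` is the only polynomial with this property
        (∀ g : ℚ[X],
          (∀ n : ℕ, WreathFH.degree ν + (ν 1).card ≤ n → ∀ a : WreathFH.ModType Γ →₀ ℤ,
            WreathFH.IsStructureConstants n lam mu a → g.eval (n : ℚ) = (a ν : ℚ)) →
          g = f ν) ∧
        -- the degree
        (WreathFH.pairClasses lam mu ν = ∅ → f ν = 0) ∧
        ((WreathFH.pairClasses lam mu ν).Nonempty → f ν ≠ 0 ∧
          ∀ z ∈ WreathFH.classInf ν,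
            IsGreatest {d : ℤ | ∃ C ∈ WreathFH.pairClasses lam mu ν,
              d = (C.suppCard : ℤ) - ((WreathFH.suppSet {z}).ncard : ℤ)}
              ((f ν).natDegree : ℤ)) ∧
        -- the case of equal degrees
        (WreathFH.degree ν = WreathFH.degree lam + WreathFH.degree mu →
          (∃ k : ℕ, f ν = Polynomial.C (k : ℚ)) ∧
          ∀ x ∈ WreathFH.classInf lam, ∀ y ∈ WreathFH.classInf mu,
            x * y ∈ WreathFH.classInf ν →
              WreathFH.suppSet {x, y} = WreathFH.suppSet {x * y}) := by
  refine ⟨Finsupp.ofSupportFinite (WreathFH.structurePoly lam mu)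
      (WreathFH.finite_support_structurePoly lam mu),
    WreathFH.exists_isStructureConstants lam mu, fun ν => ⟨?_, ?_, ?_, ?_, ?_⟩⟩
  · exact fun n hn a ha => WreathFH.eval_structurePoly_eq_of_isStructureConstants hn ha
  · exact fun g hg => WreathFH.eq_structurePoly_of_eval_eq hg
  · exact WreathFH.structurePoly_eq_zero_iff_pairClasses_eq_empty.2
  · exact fun hne => ⟨WreathFH.structurePoly_eq_zero_iff_pairClasses_eq_empty.not.2 hne.ne_empty,
      fun z hz => WreathFH.isGreatest_natDegree_structurePoly_pairClasses hne hz⟩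
  · exact fun hdeg => ⟨⟨_, WreathFH.structurePoly_eq_C hdeg⟩,
      fun x hx y hy hxy => WreathFH.suppSet_pair_eq_suppSet_mul hdeg hx hy hxy⟩
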